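/- Let $(B,g_B)$ and $(F_1,g_{F_1}),\dots,(F_m,g_{F_m})$ be connected smooth (finite-dimensional, boundaryless) pseudo-Riemannian manifolds with $\dim F_i>1$ for every $i$, and let $b_i:B\times F_i\to(0,\infty)$ be smooth. Let $M=B\times_{b_1}F_1\times\cdots\times_{b_m}F_m$ be the multiply twisted product, i.e. the manifold $B\times F_1\times\cdots\times F_m$ with the metric $$g=g_B\oplus b_1^2g_{F_1}\oplus\cdots\oplus b_m^2g_{F_m}.$$ Let $P$ be a smooth vector field on $B$, regarded also as a vector field on $M$ by lifting it, let $\nabla$ be the Levi-Civita connection of $g$, put $\pi(X)=g(X,P)$, and let $$\overline\nabla_XY=\nabla_XY+\pi(Y)X-g(X,Y)P$$ be the semi-symmetric metric connection generated by $P$. Let $\overline R(X,Y)Z=\overline\nabla_X\overline\nabla_YZ-\overline\nabla_Y\overline\nabla_XZ-\overline\nabla_{[X,Y]}Z$ and $\overline{\mathrm{Ric}}(X,Y)=\operatorname{tr}\bigl(Z\mapsto\overline R(X,Z)Y\bigr)=\sum_k\varepsilon_k\,g(\overline R(X,E_k)Y,E_k)$, where $(E_k)$ is a $g$-orthonormal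 basis and $\varepsilon_k=g(E_k,E_k)$. Then $(M,\overline\nabla)$ is mixed Ricci-flat, i.e. $\overline{\mathrm{Ric}}(X,V)=\overline{\mathrm{Ric}}(V,X)=0$ for all $X$ tangent to $B$ and all $V$ tangent to one of the $F_i$, if and only if $M$ can be expressed as a multiply warped product, i.e. there are pseudo-Riemannian metrics $g_B'$ on $B$ and $g_{F_i}'$ on $F_i$ and smooth functions $\varphi_i:B\to(0,\infty)$ with $$g=g_B'\oplus\varphi_1^2g_{F_1}'\oplus\cdots\oplus\varphi_m^2g_{F_m}'.$$ In particular, if $(M,\overline\nabla)$ is Einstein, i.e. $\overline{\mathrm{Ric}}=\lambda g$ for some constant $\lambda\in\mathbb R$, then $M$ can be expressed as a multiply warped product. -/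

import Mathlib

open scoped Manifold ContDiff Bundle
open Bundle

set_option linter.unusedSectionVars false

noncomputable section

section Generic

variable {E : Type*} [NormedAddCommGroup E] [NormedSpace ℝ E] [FiniteDimensional ℝ E]
  {H : Type*} [TopologicalSpace H] (I : ModelWithCorners ℝ E H)
  (M : Type*) [TopologicalSpace M] [ChartedSpace H M] [IsManifold I ∞ M]

/-- A smooth pseudo-Riemannian metric: a smooth field of symmetric nondegenerate bilinear forms on
the tangent spaces, of arbitrary signature. -/
structure PseudoRiemannianMetric where
  val (x : M) : TangentSpace I x →L[ℝ] TangentSpace I x →L[ℝ] ℝ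
  symm (x : M) (u v : TangentSpace I x) : val x u v = val x v u
  nondegenerate (x : M) (u : TangentSpace I x) (h : ∀ v, val x u v = 0) : u = 0
  contMDiff : ContMDiff I (I.prod 𝓘(ℝ, E →L[ℝ] E →L[ℝ] ℝ)) ∞
    (fun x ↦ TotalSpace.mk' (E →L[ℝ] E →L[ℝ] ℝ) x (val x))

variable {I M}

namespace PseudoRiemannianMetric

variable (g : PseudoRiemannianMetric I M)

instance (x : M) : FiniteDimensional ℝ (TangentSpace I x) :=
  inferInstanceAs (FiniteDimensional ℝ E)

instance (x : M) : T2Space (TangentSpace I x) :=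
  inferInstanceAs (T2Space E)

/-- The isomorphism `T_x M → (T_x M)^*`, `u ↦ g(u, ·)`. -/
def flat (x : M) : TangentSpace I x ≃ₗ[ℝ] Module.Dual ℝ (TangentSpace I x) :=
  LinearEquiv.ofInjectiveOfFinrankEq
    ({ toFun := fun u ↦ (g.val x u).toLinearMap
       map_add' := fun u v ↦ by ext; simp
       map_smul' := fun c u ↦ by ext; simp } :
      TangentSpace I x →ₗ[ℝ] Module.Dual ℝ (TangentSpace I x))
    (by
      rw [← LinearMap.ker_eq_bot, LinearMap.ker_eq_bot']
      intro u hu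
      exact g.nondegenerate x u fun v ↦ by simpa using LinearMap.congr_fun hu v)
    Subspace.dual_finrank_eq.symm

lemma flat_apply (x : M) (u v : TangentSpace I x) : g.flat x u v = g.val x u v := rfl

lemma mdifferentiableAt_val {X Y : Π x : M, TangentSpace I x} {x : M}
    (hX : MDiffAt (T% X) x) (hY : MDiffAt (T% Y) x) :
    MDiffAt (fun y ↦ g.val y (X y) (Y y)) x := by
  have h : MDifferentiableAt I (I.prod 𝓘(ℝ))
      (fun m ↦ TotalSpace.mk' ℝ (E := Bundle.Trivial M ℝ) m (g.val m (X m) (Y m))) x := by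
    apply MDifferentiableAt.clm_bundle_apply₂ (F₁ := E) (F₂ := E)
    · exact g.contMDiff.mdifferentiableAt (by simp)
    · exact hX
    · exact hY
  rw [mdifferentiableAt_totalSpace] at h
  exact h.2

/-- The right-hand side of the Koszul formula
`2 g(∇_X Y, Z) = X g(Y,Z) + Y g(X,Z) - Z g(X,Y) + g([X,Y],Z) - g([X,Z],Y) - g([Y,Z],X)`. -/
def koszul (X Y Z : Π x : M, TangentSpace I x) (x : M) : ℝ :=
  mvfderiv I (fun y ↦ g.val y (Y y) (Z y)) x (X x)
  + mvfderiv I (fun y ↦ g.val y (X y) (Z y)) x (Y x)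
  - mvfderiv I (fun y ↦ g.val y (X y) (Y y)) x (Z x)
  + g.val x (VectorField.mlieBracket I X Y x) (Z x)
  - g.val x (VectorField.mlieBracket I X Z x) (Y x)
  - g.val x (VectorField.mlieBracket I Y Z x) (X x)

/-- For fixed `X`, `Y`, the Koszul expression is tensorial in `Z`. -/
lemma tensorialAt_koszul {X Y : Π x : M, TangentSpace I x} {x : M}
    (hX : MDiffAt (T% X) x) (hY : MDiffAt (T% Y) x) :
    TensorialAt I E (fun Z ↦ g.koszul X Y Z x) x where
  smul {f Z} hf hZ := by
    have : IsManifold I 2 M := inferInstance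
    have e1 : (fun y ↦ g.val y (Y y) ((f • Z) y)) = f * fun y ↦ g.val y (Y y) (Z y) := by
      ext y; simp
    have e2 : (fun y ↦ g.val y (X y) ((f • Z) y)) = f * fun y ↦ g.val y (X y) (Z y) := by
      ext y; simp
    simp only [koszul]
    rw [e1, e2, mvfderiv_mul hf (g.mdifferentiableAt_val hY hZ),
      mvfderiv_mul hf (g.mdifferentiableAt_val hX hZ),
      VectorField.mlieBracket_smul_right hf hZ, VectorField.mlieBracket_smul_right hf hZ]
    simp
    rw [g.symm x (Z x) (X x), g.symm x (Z x) (Y x)]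
    ring
  add {Z Z'} hZ hZ' := by
    have e1 : (fun y ↦ g.val y (Y y) ((Z + Z') y))
        = (fun y ↦ g.val y (Y y) (Z y)) + fun y ↦ g.val y (Y y) (Z' y) := by
      ext y; simp
    have e2 : (fun y ↦ g.val y (X y) ((Z + Z') y))
        = (fun y ↦ g.val y (X y) (Z y)) + fun y ↦ g.val y (X y) (Z' y) := by
      ext y; simp
    simp only [koszul]
    rw [e1, e2, mvfderiv_add (g.mdifferentiableAt_val hY hZ) (g.mdifferentiableAt_val hY hZ'),
      mvfderiv_add (g.mdifferentiableAt_val hX hZ) (g.mdifferentiableAt_val hX hZ'),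
      VectorField.mlieBracket_add_right hZ hZ', VectorField.mlieBracket_add_right hZ hZ']
    simp
    ring

open Classical in
/-- The Levi-Civita connection `∇_X Y` of `g`: at a point `x` where `X` and `Y` are differentiable,
`(∇_X Y)(x)` is the tangent vector determined by the Koszul formula. The junk value at other points
is never used. -/
def leviCivita (X Y : Π x : M, TangentSpace I x) (x : M) : TangentSpace I x :=
  if h : MDiffAt (T% X) x ∧ MDiffAt (T% Y) x then
    (g.flat x).symm ((1 / 2 : ℝ) •
      (TensorialAt.mkHom (fun Z ↦ g.koszul X Y Z x) x (g.tensorialAt_koszul h.1 h.2)).toLinearMap)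
  else 0

/-- The Koszul formula. -/
lemma two_mul_val_leviCivita {X Y Z : Π x : M, TangentSpace I x} {x : M}
    (hX : MDiffAt (T% X) x) (hY : MDiffAt (T% Y) x) (hZ : MDiffAt (T% Z) x) :
    2 * g.val x (g.leviCivita X Y x) (Z x) = g.koszul X Y Z x := by
  rw [leviCivita, dif_pos ⟨hX, hY⟩, ← flat_apply, LinearEquiv.apply_symm_apply]
  have := TensorialAt.mkHom_apply (g.tensorialAt_koszul hX hY) hZ
  simp [this]

/-- Yano's semi-symmetric metric connection with generating vector field `P`,
`∇̄_X Y = ∇_X Y + π(Y) X - g(X, Y) P`, where `π(X) = g(X, P)`. -/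
def semiSymmetricConnection (P X Y : Π x : M, TangentSpace I x) (x : M) : TangentSpace I x :=
  g.leviCivita X Y x + g.val x (Y x) (P x) • X x - g.val x (X x) (Y x) • P x

/-- The connection is metric: `∇̄ g = 0`. -/
lemma semiSymmetricConnection_metric {P X Y Z : Π x : M, TangentSpace I x} {x : M}
    (hX : MDiffAt (T% X) x) (hY : MDiffAt (T% Y) x) (hZ : MDiffAt (T% Z) x) :
    mvfderiv I (fun y ↦ g.val y (Y y) (Z y)) x (X x) =
      g.val x (g.semiSymmetricConnection P X Y x) (Z x) +
        g.val x (Y x) (g.semiSymmetricConnection P X Z x) := by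
  have h1 := g.two_mul_val_leviCivita hX hY hZ
  have h2 := g.two_mul_val_leviCivita hX hZ hY
  have e : (fun y ↦ g.val y (Z y) (Y y)) = fun y ↦ g.val y (Y y) (Z y) := by
    ext y; exact g.symm _ _ _
  simp only [koszul] at h1 h2
  rw [e, VectorField.mlieBracket_swap_apply (V := Z) (W := Y)] at h2
  simp [semiSymmetricConnection] at h1 h2 ⊢
  rw [g.symm x (Y x) (g.leviCivita X Z x), g.symm x (Y x) (X x), g.symm x (P x) (Z x)]
  linear_combination (-1 / 2 : ℝ) * h1 - (1 / 2 : ℝ) * h2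

/-- The connection is semi-symmetric: its torsion is `T(X,Y) = π(Y) X - π(X) Y`. -/
lemma semiSymmetricConnection_torsion {P X Y : Π x : M, TangentSpace I x} {x : M}
    (hX : MDiffAt (T% X) x) (hY : MDiffAt (T% Y) x) :
    g.semiSymmetricConnection P X Y x - g.semiSymmetricConnection P Y X x
        - VectorField.mlieBracket I X Y x =
      g.val x (Y x) (P x) • X x - g.val x (X x) (P x) • Y x := by
  have h : g.leviCivita X Y x - g.leviCivita Y X x = VectorField.mlieBracket I X Y x := by
    rw [← sub_eq_zero]
    refine g.nondegenerate x _ fun v ↦ ?_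
    have hv : MDiffAt (T% (FiberBundle.extend E v)) x := FiberBundle.mdifferentiableAt_extend ..
    have h1 := g.two_mul_val_leviCivita hX hY hv
    have h2 := g.two_mul_val_leviCivita hY hX hv
    have e : (fun y ↦ g.val y (Y y) (X y)) = fun y ↦ g.val y (X y) (Y y) := by
      ext y; exact g.symm _ _ _
    simp only [koszul] at h1 h2
    rw [e, VectorField.mlieBracket_swap_apply (V := Y) (W := X)] at h2
    simp at h1 h2 ⊢
    linear_combination (1 / 2 : ℝ) * h1 - (1 / 2 : ℝ) * h2
  simp only [semiSymmetricConnection, ← h, g.symm x (Y x) (X x)]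
  abel

end PseudoRiemannianMetric

/-- The curvature `R(X,Y)Z = ∇_X ∇_Y Z - ∇_Y ∇_X Z - ∇_[X,Y] Z` of a connection `D X Y = ∇_X Y`. -/
def curvatureOf (D : (Π x : M, TangentSpace I x) → (Π x : M, TangentSpace I x) →
      Π x : M, TangentSpace I x)
    (X Y Z : Π x : M, TangentSpace I x) : Π x : M, TangentSpace I x :=
  D X (D Y Z) - D Y (D X Z) - D (VectorField.mlieBracket I X Y) Z

/-- The Ricci tensor `Ric(u,v) = ∑ ε_k ⟨R(u,E_k)v, E_k⟩` of a connection, for tangent vectors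
`u`, `v` at `x`. The sum is the trace of `w ↦ R(u,w)v`, computed here in a basis of `T_x M`; the
tangent vectors are extended to vector fields that are smooth near `x`, which is harmless because
the curvature is a tensor. -/
def ricciOf (D : (Π x : M, TangentSpace I x) → (Π x : M, TangentSpace I x) →
      Π x : M, TangentSpace I x) (x : M) (u v : TangentSpace I x) : ℝ :=
  ∑ k, (Module.finBasis ℝ (TangentSpace I x)).coord k
    (curvatureOf D (FiberBundle.extend E u)
      (FiberBundle.extend E (Module.finBasis ℝ (TangentSpace I x) k))
      (FiberBundle.extend E v) x)

end Generic

section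
variable {ι : Type*} [Fintype ι] {E : ι → Type*} [∀ i, NormedAddCommGroup (E i)]
  [∀ i, NormedSpace ℝ (E i)] {H : ι → Type*} [∀ i, TopologicalSpace (H i)]
  (I : ∀ i, ModelWithCorners ℝ (E i) (H i))
  (M : ι → Type*) [∀ i, TopologicalSpace (M i)] [∀ i, ChartedSpace (H i) (M i)]

instance isManifold_pi {n : ℕ∞ω} [∀ i, IsManifold (I i) n (M i)] :
    IsManifold (ModelWithCorners.pi I) n (∀ i, M i) := by
  refine isManifold_of_contDiffOn _ _ _ ?_
  rintro _ _ ⟨e, he, rfl⟩ ⟨e', he', rfl⟩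
  rw [contDiffOn_pi]
  intro i
  have h1 := contDiffGroupoid n (I i) |>.compatible (he i trivial) (he' i trivial)
  have h2 := (mem_groupoid_of_pregroupoid.1 h1).1
  refine ContDiffOn.comp (g := (I i) ∘ ((e i).symm ≫ₕ e' i) ∘ (I i).symm)
    (f := fun x : (∀ i, E i) => x i) h2 ?_ ?_
  · exact (ContinuousLinearMap.proj (R := ℝ) (φ := E) i).contDiff.contDiffOn
  · rintro x ⟨hx, ⟨y, rfl⟩⟩
    refine ⟨?_, ⟨y i, rfl⟩⟩
    exact ⟨hx.1 i trivial, hx.2 i trivial⟩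

theorem extChartAt_pi_target (x : ∀ i, M i) {y : ∀ i, E i}
   (hy : y ∈ (extChartAt (ModelWithCorners.pi I) x).target) (i : ι) : y i ∈ (extChartAt (I i) (x i)).target := by
  rw [extChartAt_target] at hy ⊢
  refine ⟨hy.1 i trivial, ?_⟩
  obtain ⟨z, rfl⟩ := hy.2
  exact ⟨z i, rfl⟩

theorem hasMFDerivAt_eval (i : ι) (x : ∀ i, M i) :
    HasMFDerivAt (ModelWithCorners.pi I) (I i) (fun x : ∀ i, M i ↦ x i) x
      (ContinuousLinearMap.proj (R := ℝ) (φ := E) i) := by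
  refine ⟨(continuous_apply i).continuousAt, ?_⟩
  refine ((ContinuousLinearMap.proj (R := ℝ) (φ := E) i).hasFDerivWithinAt).congr_of_eventuallyEq ?_ ?_
  · filter_upwards [extChartAt_target_mem_nhdsWithin (I := ModelWithCorners.pi I) x] with y hy
    have : y i ∈ (extChartAt (I i) (x i)).target := extChartAt_pi_target I M x hy i
    exact (extChartAt (I i) (x i)).right_inv this
  · exact (extChartAt (I i) (x i)).right_inv (mem_extChartAt_target (I := I i) (x i))

theorem contMDiff_eval {n : ℕ∞ω} (i : ι) :
    ContMDiff (ModelWithCorners.pi I) (I i) n (fun x : ∀ i, M i ↦ x i) := by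
  intro x
  rw [contMDiffAt_iff]
  refine ⟨(continuous_apply i).continuousAt, ?_⟩
  refine ((ContinuousLinearMap.proj (R := ℝ) (φ := E) i).contDiff.contDiffWithinAt).congr_of_eventuallyEq ?_ ?_
  · filter_upwards [extChartAt_target_mem_nhdsWithin (I := ModelWithCorners.pi I) x] with y hy
    have : y i ∈ (extChartAt (I i) (x i)).target := extChartAt_pi_target I M x hy i
    exact (extChartAt (I i) (x i)).right_inv this
  · exact (extChartAt (I i) (x i)).right_inv (mem_extChartAt_target (I := I i) (x i))

end

section Bilin
variable {E : Type*} [NormedAddCommGroup E] [NormedSpace ℝ E] [FiniteDimensional ℝ E]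
  {H : Type*} [TopologicalSpace H] {I : ModelWithCorners ℝ E H}
  {M : Type*} [TopologicalSpace M] [ChartedSpace H M] [IsManifold I ∞ M]

lemma clm_bilin_expand (Φ : E →L[ℝ] E →L[ℝ] ℝ) :
    Φ = ∑ i, ∑ j, Φ (Module.finBasis ℝ E i) (Module.finBasis ℝ E j) •
      (((Module.finBasis ℝ E).coord i).toContinuousLinearMap.smulRight
        ((Module.finBasis ℝ E).coord j).toContinuousLinearMap) := by
  refine ContinuousLinearMap.coe_injective ((Module.finBasis ℝ E).ext fun i ↦ ?_)
  refine ContinuousLinearMap.coe_injective ((Module.finBasis ℝ E).ext fun j ↦ ?_)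
  simp [Finsupp.single_apply]

lemma contMDiff_bilin (A : ∀ x : M, TangentSpace I x →L[ℝ] TangentSpace I x →L[ℝ] ℝ)
    (h : ∀ (x₀ : M) (X Y : Π x : M, TangentSpace I x), CMDiffAt ∞ (T% X) x₀ →
      CMDiffAt ∞ (T% Y) x₀ → CMDiffAt ∞ (fun x ↦ A x (X x) (Y x)) x₀) :
    ContMDiff I (I.prod 𝓘(ℝ, E →L[ℝ] E →L[ℝ] ℝ)) ∞
      (fun x ↦ TotalSpace.mk' (E →L[ℝ] E →L[ℝ] ℝ) x (A x)) := by
  intro x₀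
  rw [contMDiffAt_hom_bundle]
  refine ⟨contMDiffAt_id, ?_⟩
  have key (e e' : E) : CMDiffAt ∞ (fun x ↦ ContinuousLinearMap.inCoordinates E (TangentSpace I) (E →L[ℝ] ℝ)
      (fun x : M ↦ TangentSpace I x →L[ℝ] ℝ) x₀ x x₀ x (A x) e e') x₀ := by
    have hs (e : E) : CMDiffAt ∞ (T% (fun x : M ↦ (trivializationAt E (TangentSpace I) x₀).symm x e)) x₀ := by
      rw [contMDiffAt_section]
      refine (contMDiffAt_const (c := e)).congr_of_eventuallyEq ?_
      filter_upwards [(trivializationAt E (TangentSpace I) x₀).open_baseSet.mem_nhds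
        (FiberBundle.mem_baseSet_trivializationAt' x₀)] with x hx
      simp [(trivializationAt E (TangentSpace I) x₀).apply_mk_symm hx]
    refine (h x₀ _ _ (hs e) (hs e')).congr_of_eventuallyEq ?_
    filter_upwards [(trivializationAt E (TangentSpace I) x₀).open_baseSet.mem_nhds
        (FiberBundle.mem_baseSet_trivializationAt' x₀)] with x hx
    have := inCoordinates_apply_eq₂ (F₁ := E) (F₂ := E) (F₃ := ℝ) (E₁ := fun x : M ↦ TangentSpace I x) (E₂ := fun x : M ↦ TangentSpace I x) (E₃ := Bundle.Trivial M ℝ) (x₀ := x₀) (x := x) (ϕ := A x) (v := e) (w := e') hx hx (by simp)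
    refine this.trans ?_
    simp
  have : (fun x ↦ ContinuousLinearMap.inCoordinates E (TangentSpace I) (E →L[ℝ] ℝ)
      (fun x : M ↦ TangentSpace I x →L[ℝ] ℝ) x₀ x x₀ x (A x)) = fun x ↦ ∑ i, ∑ j, 
       (ContinuousLinearMap.inCoordinates E (TangentSpace I) (E →L[ℝ] ℝ)
      (fun x : M ↦ TangentSpace I x →L[ℝ] ℝ) x₀ x x₀ x (A x)) (Module.finBasis ℝ E i) (Module.finBasis ℝ E j) •
      (((Module.finBasis ℝ E).coord i).toContinuousLinearMap.smulRight
        ((Module.finBasis ℝ E).coord j).toContinuousLinearMap) := by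
    ext1 x; exact clm_bilin_expand _
  show CMDiffAt ∞ (fun x ↦ ContinuousLinearMap.inCoordinates E (TangentSpace I) (E →L[ℝ] ℝ)
      (fun x : M ↦ TangentSpace I x →L[ℝ] ℝ) x₀ x x₀ x (A x)) x₀
  rw [this]
  refine ContMDiffAt.sum fun i _ ↦ ContMDiffAt.sum fun j _ ↦ (key _ _).smul contMDiffAt_const

end Bilin

section Product

variable {EB : Type*} [NormedAddCommGroup EB] [NormedSpace ℝ EB] [FiniteDimensional ℝ EB]
  {HB : Type*} [TopologicalSpace HB] {IB : ModelWithCorners ℝ EB HB}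
  {B : Type*} [TopologicalSpace B] [ChartedSpace HB B] [IsManifold IB ∞ B]
  {ι : Type*} [Fintype ι]
  {EF : ι → Type*} [∀ i, NormedAddCommGroup (EF i)] [∀ i, NormedSpace ℝ (EF i)]
  [∀ i, FiniteDimensional ℝ (EF i)]
  {HF : ι → Type*} [∀ i, TopologicalSpace (HF i)] {IF : ∀ i, ModelWithCorners ℝ (EF i) (HF i)}
  {F : ι → Type*} [∀ i, TopologicalSpace (F i)] [∀ i, ChartedSpace (HF i) (F i)]
  [∀ i, IsManifold (IF i) ∞ (F i)]

variable (IB IF) in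
/-- The model with corners of the product manifold `B × F₁ × ⋯ × F_m`. -/
abbrev productModel : ModelWithCorners ℝ (EB × ∀ i, EF i) (ModelProd HB (ModelPi HF)) :=
  IB.prod (ModelWithCorners.pi IF)

/-- The component in `T B` of a tangent vector of `B × F₁ × ⋯ × F_m`. -/
def basePart (x : B × ∀ i, F i) :
    TangentSpace (productModel IB IF) x →L[ℝ] TangentSpace IB x.1 :=
  ContinuousLinearMap.fst ℝ EB (∀ i, EF i)

/-- The component in `T F_i` of a tangent vector of `B × F₁ × ⋯ × F_m`. -/
def fiberPart (i : ι) (x : B × ∀ i, F i) :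
    TangentSpace (productModel IB IF) x →L[ℝ] TangentSpace (IF i) (x.2 i) :=
  (ContinuousLinearMap.proj (R := ℝ) (φ := EF) i).comp
    (ContinuousLinearMap.snd ℝ EB (∀ i, EF i))

/-- A tangent vector of the base, as a tangent vector of the product. -/
def ofBase (x : B × ∀ i, F i) :
    TangentSpace IB x.1 →L[ℝ] TangentSpace (productModel IB IF) x :=
  ContinuousLinearMap.inl ℝ EB (∀ i, EF i)

/-- A tangent vector of the `i`-th fibre, as a tangent vector of the product. -/
def ofFiber [DecidableEq ι] (i : ι) (x : B × ∀ i, F i) :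
    TangentSpace (IF i) (x.2 i) →L[ℝ] TangentSpace (productModel IB IF) x :=
  (ContinuousLinearMap.inr ℝ EB (∀ i, EF i)).comp (ContinuousLinearMap.single ℝ EF i)

lemma basePart_ofBase (x : B × ∀ i, F i) (u : TangentSpace IB x.1) :
    basePart (IB := IB) (IF := IF) x (ofBase x u) = u := rfl

lemma fiberPart_ofBase (i : ι) (x : B × ∀ i, F i) (u : TangentSpace IB x.1) :
    fiberPart (IB := IB) (IF := IF) i x (ofBase x u) = 0 := rfl

lemma basePart_ofFiber [DecidableEq ι] (i : ι) (x : B × ∀ i, F i)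
    (v : TangentSpace (IF i) (x.2 i)) :
    basePart (IB := IB) (IF := IF) x (ofFiber i x v) = 0 := rfl

lemma fiberPart_ofFiber_same [DecidableEq ι] (i : ι) (x : B × ∀ i, F i)
    (v : TangentSpace (IF i) (x.2 i)) :
    fiberPart (IB := IB) (IF := IF) i x (ofFiber i x v) = v :=
  Pi.single_eq_same (M := EF) i v

lemma fiberPart_ofFiber_ne [DecidableEq ι] {i j : ι} (h : j ≠ i) (x : B × ∀ i, F i)
    (v : TangentSpace (IF i) (x.2 i)) :
    fiberPart (IB := IB) (IF := IF) j x (ofFiber i x v) = 0 :=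
  Pi.single_eq_of_ne (M := EF) h v

lemma eq_zero_of_parts {x : B × ∀ i, F i} {u : TangentSpace (productModel IB IF) x}
    (h : basePart x u = 0) (h' : ∀ i, fiberPart i x u = 0) : u = 0 :=
  Prod.ext (α := EB) (β := ∀ i, EF i) h (funext h')

/-- The lift to the product of a vector field on the base. -/
def liftBase (P : Π p : B, TangentSpace IB p) (x : B × ∀ i, F i) :
    TangentSpace (productModel IB IF) x :=
  ofBase x (P x.1)

lemma contMDiffAt_basePart {x₀ : B × ∀ i, F i}
    {X : Π x : B × ∀ i, F i, TangentSpace (productModel IB IF) x}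
    (hX : ContMDiffAt (productModel IB IF) (productModel IB IF).tangent ∞ (T% X) x₀) :
    ContMDiffAt (productModel IB IF) IB.tangent ∞
      (fun x ↦ TotalSpace.mk' EB (E := TangentSpace IB) x.1 (basePart x (X x))) x₀ := by
  have h : ContMDiff (productModel IB IF) IB ∞ (fun x : B × ∀ i, F i ↦ x.1) := contMDiff_fst
  refine ((h.contMDiff_tangentMap (m := ∞) le_rfl).contMDiffAt.comp x₀ hX).congr_of_eventuallyEq ?_
  filter_upwards with x
  simp [tangentMap, mfderiv_fst]
  rfl

lemma contMDiffAt_fiberPart (i : ι) {x₀ : B × ∀ i, F i}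
    {X : Π x : B × ∀ i, F i, TangentSpace (productModel IB IF) x}
    (hX : ContMDiffAt (productModel IB IF) (productModel IB IF).tangent ∞ (T% X) x₀) :
    ContMDiffAt (productModel IB IF) (IF i).tangent ∞
      (fun x ↦ TotalSpace.mk' (EF i) (E := TangentSpace (IF i)) (x.2 i) (fiberPart i x (X x)))
      x₀ := by
  have h : ContMDiff (productModel IB IF) (IF i) ∞ (fun x : B × ∀ i, F i ↦ x.2 i) :=
    (contMDiff_eval IF F i).comp contMDiff_snd
  refine ((h.contMDiff_tangentMap (m := ∞) le_rfl).contMDiffAt.comp x₀ hX).congr_of_eventuallyEq ?_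
  filter_upwards with x
  have := ((hasMFDerivAt_eval IF F i x.2).comp x (hasMFDerivAt_snd (I := IB) x)).mfderiv
  exact Bundle.TotalSpace.ext rfl (heq_of_eq (congrArg (fun L ↦ L (X x)) this).symm)

/-- The metric `g_B ⊕ b₁² g_{F₁} ⊕ ⋯ ⊕ b_m² g_{F_m}` of the multiply twisted product
`B ×_{b₁} F₁ × ⋯ ×_{b_m} F_m` with twisting functions `b_i : B × F_i → (0, ∞)`. -/
def multiplyTwistedMetric (gB : PseudoRiemannianMetric IB B)
    (gF : ∀ i, PseudoRiemannianMetric (IF i) (F i)) (b : ∀ i, B × F i → ℝ)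
    (hb : ∀ i, ContMDiff (IB.prod (IF i)) 𝓘(ℝ) ∞ (b i)) (hpos : ∀ i p, 0 < b i p) :
    PseudoRiemannianMetric (productModel IB IF) (B × ∀ i, F i) where
  val x := LinearMap.toContinuousBilinearMap (LinearMap.mk₂ ℝ
    (fun u v ↦ gB.val x.1 (basePart x u) (basePart x v) +
      ∑ i, b i (x.1, x.2 i) ^ 2 * (gF i).val (x.2 i) (fiberPart i x u) (fiberPart i x v))
    (fun u u' v ↦ by simp [mul_add, Finset.sum_add_distrib]; ring)
    (fun c u v ↦ by simp [mul_add, Finset.mul_sum, mul_left_comm])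
    (fun u v v' ↦ by simp [mul_add, Finset.sum_add_distrib]; ring)
    (fun c u v ↦ by simp [mul_add, Finset.mul_sum, mul_left_comm]))
  symm x u v := by
    simp only [LinearMap.toContinuousBilinearMap_apply, LinearMap.mk₂_apply]
    rw [gB.symm]
    congr 1
    exact Finset.sum_congr rfl fun i _ ↦ by rw [(gF i).symm]
  nondegenerate x u h := by
    classical
    simp only [LinearMap.toContinuousBilinearMap_apply, LinearMap.mk₂_apply] at h
    refine eq_zero_of_parts (gB.nondegenerate _ _ fun v ↦ ?_)
      (fun i ↦ (gF i).nondegenerate _ _ fun v ↦ ?_)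
    · simpa [basePart_ofBase, fiberPart_ofBase] using h (ofBase x v)
    · have h1 := h (ofFiber i x v)
      rw [Finset.sum_eq_single i (fun j _ hj ↦ by simp [fiberPart_ofFiber_ne hj])
        (by simp), basePart_ofFiber, fiberPart_ofFiber_same] at h1
      simpa [(hpos i _).ne'] using h1
  contMDiff := by
    refine contMDiff_bilin _ fun x₀ X Y hX hY ↦ ?_
    simp only [LinearMap.toContinuousBilinearMap_apply, LinearMap.mk₂_apply]
    refine ContMDiffAt.add ?_ (ContMDiffAt.sum fun i _ ↦ ContMDiffAt.mul (ContMDiffAt.pow ?_ 2) ?_)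
    · have h : ContMDiffAt (productModel IB IF) (IB.prod 𝓘(ℝ)) ∞
          (fun x ↦ TotalSpace.mk' ℝ (E := Bundle.Trivial B ℝ) x.1
            (gB.val x.1 (basePart x (X x)) (basePart x (Y x)))) x₀ :=
        ContMDiffAt.clm_bundle_apply₂ (F₁ := EB) (F₂ := EB)
          (gB.contMDiff.contMDiffAt.comp x₀ contMDiffAt_fst)
          (contMDiffAt_basePart hX) (contMDiffAt_basePart hY)
      rw [contMDiffAt_totalSpace] at h
      exact h.2
    · exact (hb i).contMDiffAt.comp x₀ (contMDiffAt_fst.prodMk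
        ((contMDiff_eval IF F i).contMDiffAt.comp x₀ contMDiffAt_snd))
    · have h : ContMDiffAt (productModel IB IF) ((IF i).prod 𝓘(ℝ)) ∞
          (fun x ↦ TotalSpace.mk' ℝ (E := Bundle.Trivial (F i) ℝ) (x.2 i)
            ((gF i).val (x.2 i) (fiberPart i x (X x)) (fiberPart i x (Y x)))) x₀ :=
        ContMDiffAt.clm_bundle_apply₂ (F₁ := EF i) (F₂ := EF i)
          ((gF i).contMDiff.contMDiffAt.comp x₀
            ((contMDiff_eval IF F i).contMDiffAt.comp x₀ contMDiffAt_snd))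
          (contMDiffAt_fiberPart i hX) (contMDiffAt_fiberPart i hY)
      rw [contMDiffAt_totalSpace] at h
      exact h.2

/-- The metric of the multiply warped product `B ×_{b₁} F₁ × ⋯ ×_{b_m} F_m`, with warping
functions `b_i : B → (0, ∞)`. -/
def multiplyWarpedMetric (gB : PseudoRiemannianMetric IB B)
    (gF : ∀ i, PseudoRiemannianMetric (IF i) (F i)) (b : ι → B → ℝ)
    (hb : ∀ i, ContMDiff IB 𝓘(ℝ) ∞ (b i)) (hpos : ∀ i p, 0 < b i p) :
    PseudoRiemannianMetric (productModel IB IF) (B × ∀ i, F i) :=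
  multiplyTwistedMetric gB gF (fun i p ↦ b i p.1) (fun i ↦ (hb i).comp contMDiff_fst)
    (fun i p ↦ hpos i p.1)

/-- `(B × F₁ × ⋯ × F_m, g)` can be expressed as a multiply warped product with base `B` and fibres
`F_i`, for suitable metrics on them and suitable warping functions. -/
def IsMultiplyWarped (g : PseudoRiemannianMetric (productModel IB IF) (B × ∀ i, F i)) : Prop :=
  ∃ (gB : PseudoRiemannianMetric IB B) (gF : ∀ i, PseudoRiemannianMetric (IF i) (F i))
    (b : ι → B → ℝ) (hb : ∀ i, ContMDiff IB 𝓘(ℝ) ∞ (b i)) (hpos : ∀ i p, 0 < b i p),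
    g = multiplyWarpedMetric gB gF b hb hpos

/-- `B × F₁ × ⋯ × F_m` with a connection is mixed Ricci-flat if `Ric(X,V) = Ric(V,X) = 0` for all
`X` tangent to `B` and all `V` tangent to one of the `F_i`. -/
def IsMixedRicciFlat [DecidableEq ι]
    (D : (Π x : B × ∀ i, F i, TangentSpace (productModel IB IF) x) →
      (Π x : B × ∀ i, F i, TangentSpace (productModel IB IF) x) →
      Π x : B × ∀ i, F i, TangentSpace (productModel IB IF) x) : Prop :=
  ∀ (x : B × ∀ i, F i) (u : TangentSpace IB x.1) (i : ι) (v : TangentSpace (IF i) (x.2 i)),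
    ricciOf D x (ofBase x u) (ofFiber i x v) = 0 ∧ ricciOf D x (ofFiber i x v) (ofBase x u) = 0

/-- `(M, D)` is Einstein with respect to the metric `g`: `Ric = c g` for some constant `c`. -/
def IsEinstein {E : Type*} [NormedAddCommGroup E] [NormedSpace ℝ E] [FiniteDimensional ℝ E]
    {H : Type*} [TopologicalSpace H] {I : ModelWithCorners ℝ E H}
    {M : Type*} [TopologicalSpace M] [ChartedSpace H M] [IsManifold I ∞ M]
    (g : PseudoRiemannianMetric I M)
    (D : (Π x : M, TangentSpace I x) → (Π x : M, TangentSpace I x) → Π x : M, TangentSpace I x) :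
    Prop :=
  ∃ c : ℝ, ∀ (x : M) (u v : TangentSpace I x), ricciOf D x u v = c * g.val x u v

end Product

end

noncomputable section

open Filter Topology Set

set_option maxSynthPendingDepth 3

section ChartFrame

variable {E : Type*} [NormedAddCommGroup E] [NormedSpace ℝ E] [FiniteDimensional ℝ E]
  {H : Type*} [TopologicalSpace H] {I : ModelWithCorners ℝ E H} [I.Boundaryless]
  {M : Type*} [TopologicalSpace M] [ChartedSpace H M] [IsManifold I ∞ M]

/-- The coordinate frame of the chart at `x₀`, at the point `x`. -/
def chartFrame (x₀ x : M) : E →L[ℝ] TangentSpace I x :=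
  (trivializationAt E (TangentSpace I) x₀).symmL ℝ x

/-- The coordinates of tangent vectors at `x` in the chart at `x₀`. -/
def chartCoframe (x₀ x : M) : TangentSpace I x →L[ℝ] E :=
  (trivializationAt E (TangentSpace I) x₀).continuousLinearMapAt ℝ x

/-- The vector field near `x₀` with coordinate expression `Y` in the chart at `x₀`. -/
def chartField (x₀ : M) (Y : E → E) (x : M) : TangentSpace I x :=
  chartFrame x₀ x (Y (extChartAt I x₀ x))

lemma mem_baseSet_of_mem_source {x₀ x : M} (hx : x ∈ (extChartAt I x₀).source) :
    x ∈ (trivializationAt E (TangentSpace I : M → Type _) x₀).baseSet := by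
  simpa using hx

lemma chartCoframe_chartFrame {x₀ x : M} (hx : x ∈ (extChartAt I x₀).source) (u : E) :
    chartCoframe (I := I) x₀ x (chartFrame x₀ x u) = u :=
  (trivializationAt E (TangentSpace I) x₀).continuousLinearMapAt_symmL
    (mem_baseSet_of_mem_source hx) u

lemma chartFrame_chartCoframe {x₀ x : M} (hx : x ∈ (extChartAt I x₀).source)
    (u : TangentSpace I x) : chartFrame x₀ x (chartCoframe (I := I) x₀ x u) = u :=
  (trivializationAt E (TangentSpace I) x₀).symmL_continuousLinearMapAt
    (mem_baseSet_of_mem_source hx) u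

lemma chartCoframe_self (x₀ : M) (u : TangentSpace I x₀) : chartCoframe x₀ x₀ u = u := by
  rw [chartCoframe, TangentBundle.continuousLinearMapAt_trivializationAt (by simp),
    mfderiv_extChartAt_self]
  rfl

lemma chartFrame_self (x₀ : M) (u : E) : chartFrame (I := I) x₀ x₀ u = u := by
  rw [← chartCoframe_self x₀ (chartFrame (I := I) x₀ x₀ u),
    chartCoframe_chartFrame (mem_extChartAt_source x₀)]

lemma extend_eq_chartField {x₀ x : M} (hx : x ∈ (extChartAt I x₀).source)
    (u : TangentSpace I x₀) :
    (FiberBundle.extend E u : Π x : M, TangentSpace I x) x =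
      chartField (E := E) x₀ (fun _ ↦ u) x := by
  have h : (trivializationAt E (TangentSpace I) x₀ ⟨x₀, u⟩).2 = u := by
    rw [← Trivialization.continuousLinearMapAt_apply_of_mem (R := ℝ)]
    · exact chartCoframe_self x₀ u
    · exact mem_baseSet_of_mem_source (mem_extChartAt_source x₀)
  unfold FiberBundle.extend
  simp only [h]
  exact ((trivializationAt E (TangentSpace I) x₀).symmL_apply
    (mem_baseSet_of_mem_source hx) _).symm

lemma chartFrame_eq_mfderiv {x₀ x : M} (hx : x ∈ (extChartAt I x₀).source) (u : E) :
    chartFrame (I := I) x₀ x u =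
      mfderiv 𝓘(ℝ, E) I (extChartAt I x₀).symm (extChartAt I x₀ x) u := by
  rw [chartFrame, TangentBundle.symmL_trivializationAt (by simpa using hx), I.range_eq_univ,
    mfderivWithin_univ]
  rfl

lemma mdifferentiableAt_extChartAt_symm' {x₀ x : M} (hx : x ∈ (extChartAt I x₀).source) :
    MDifferentiableAt 𝓘(ℝ, E) I (extChartAt I x₀).symm (extChartAt I x₀ x) := by
  have h := mdifferentiableWithinAt_extChartAt_symm (I := I) ((extChartAt I x₀).map_source hx)
  rwa [I.range_eq_univ, mdifferentiableWithinAt_univ] at h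

lemma mvfderiv_chartFrame {G : Type*} [NormedAddCommGroup G] [NormedSpace ℝ G] {x₀ x : M}
    (hx : x ∈ (extChartAt I x₀).source) {f : M → G} (hf : MDiffAt f x) (u : E) :
    mvfderiv I f x (chartFrame x₀ x u) =
      fderiv ℝ (f ∘ (extChartAt I x₀).symm) (extChartAt I x₀ x) u := by
  rw [chartFrame_eq_mfderiv hx, ← mfderiv_eq_fderiv,
    mfderiv_comp_of_eq (by rwa [(extChartAt I x₀).left_inv hx] :
      MDiffAt f ((extChartAt I x₀).symm (extChartAt I x₀ x)))
      (mdifferentiableAt_extChartAt_symm' hx) rfl]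
  rw [(extChartAt I x₀).left_inv hx]
  rfl

lemma eventually_mem_chart_source (x₀ : M) {x : M} (hx : x ∈ (extChartAt I x₀).source) :
    ∀ᶠ x' in 𝓝 x, x' ∈ (extChartAt I x₀).source :=
  (isOpen_extChartAt_source x₀).mem_nhds hx

lemma mdifferentiableAt_chartField {x₀ x : M} (hx : x ∈ (extChartAt I x₀).source) {Y : E → E}
    (hY : DifferentiableAt ℝ Y (extChartAt I x₀ x)) :
    MDiffAt (T% (chartField (I := I) x₀ Y)) x := by
  rw [(trivializationAt E (TangentSpace I) x₀).mdifferentiableAt_section_iff I _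
    (mem_baseSet_of_mem_source hx)]
  have h : MDifferentiableAt I 𝓘(ℝ, E) (fun x' ↦ Y (extChartAt I x₀ x')) x :=
    hY.mdifferentiableAt.comp x (mdifferentiableAt_extChartAt (by simpa using hx))
  refine h.congr_of_eventuallyEq ?_
  filter_upwards [eventually_mem_chart_source x₀ hx] with x' hx'
  rw [← Trivialization.continuousLinearMapAt_apply_of_mem (R := ℝ) _
    (mem_baseSet_of_mem_source hx')]
  exact chartCoframe_chartFrame hx' _

/-- A map `E → E`, as a vector field on the manifold `E`. -/
def modelField (Y : E → E) (y : E) : TangentSpace 𝓘(ℝ, E) y := Y y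

lemma chartField_eq_mpullback {x₀ x : M} (hx : x ∈ (extChartAt I x₀).source) (Y : E → E) :
    chartField (I := I) x₀ Y x =
      VectorField.mpullback I 𝓘(ℝ, E) (extChartAt I x₀) (modelField Y) x := by
  have h := isInvertible_mfderiv_extChartAt (I := I) hx
  rw [VectorField.mpullback_apply]
  apply h.injective
  rw [h.self_apply_inverse,
    ← TangentBundle.continuousLinearMapAt_trivializationAt (by simpa using hx)]
  exact chartCoframe_chartFrame hx _

lemma mdifferentiableAt_modelField {Y : E → E} {y : E} (hY : DifferentiableAt ℝ Y y) :
    MDiffAt (T% (modelField Y)) y := by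
  rw [mdifferentiableAt_section]
  refine hY.mdifferentiableAt.congr_of_eventuallyEq (Eventually.of_forall fun z ↦ ?_)
  simp [modelField]

lemma mlieBracket_modelField (X Y : E → E) :
    VectorField.mlieBracket 𝓘(ℝ, E) (modelField X) (modelField Y) =
      modelField (fun y ↦ fderiv ℝ Y y (X y) - fderiv ℝ X y (Y y)) := by
  ext1 y
  rw [← VectorField.mlieBracketWithin_univ, VectorField.mlieBracketWithin_eq_lieBracketWithin]
  exact congrFun (VectorField.lieBracketWithin_univ (𝕜 := ℝ) (V := X) (W := Y)) y

lemma mlieBracket_chartField {x₀ x : M} (hx : x ∈ (extChartAt I x₀).source) {X Y : E → E}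
    (hX : DifferentiableAt ℝ X (extChartAt I x₀ x))
    (hY : DifferentiableAt ℝ Y (extChartAt I x₀ x)) :
    VectorField.mlieBracket I (chartField x₀ X) (chartField x₀ Y) x =
      chartField (I := I) x₀ (fun y ↦ fderiv ℝ Y y (X y) - fderiv ℝ X y (Y y)) x := by
  have : IsManifold I (minSmoothness ℝ 2) M := by
    rw [minSmoothness_of_isRCLikeNormedField]; infer_instance
  have hev (Z : E → E) : chartField (I := I) x₀ Z =ᶠ[𝓝 x]
      VectorField.mpullback I 𝓘(ℝ, E) (extChartAt I x₀) (modelField Z) := by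
    filter_upwards [eventually_mem_chart_source x₀ hx] with x' hx'
    exact chartField_eq_mpullback hx' Z
  rw [(hev X).mlieBracket_vectorField_eq (hev Y),
    ← VectorField.mpullback_mlieBracket (n := 2) (mdifferentiableAt_modelField hX)
    (mdifferentiableAt_modelField hY) (contMDiffAt_extChartAt' (by simpa using hx))
    (by simp), chartField_eq_mpullback hx, mlieBracket_modelField]

end ChartFrame

section MetricInChart

variable {E : Type*} [NormedAddCommGroup E] [NormedSpace ℝ E] [FiniteDimensional ℝ E]
  {H : Type*} [TopologicalSpace H] {I : ModelWithCorners ℝ E H} [I.Boundaryless]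
  {M : Type*} [TopologicalSpace M] [ChartedSpace H M] [IsManifold I ∞ M]

lemma contMDiffAt_chartField_const {x₀ x : M} (hx : x ∈ (extChartAt I x₀).source) (u : E) :
    CMDiffAt ∞ (T% (chartField (I := I) x₀ (fun _ : E ↦ u))) x := by
  rw [(trivializationAt E (TangentSpace I) x₀).contMDiffAt_section_iff
    (mem_baseSet_of_mem_source hx)]
  refine (contMDiffAt_const (c := u)).congr_of_eventuallyEq ?_
  filter_upwards [eventually_mem_chart_source x₀ hx] with x' hx'
  rw [← Trivialization.continuousLinearMapAt_apply_of_mem (R := ℝ) _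
    (mem_baseSet_of_mem_source hx')]
  exact chartCoframe_chartFrame hx' _

namespace PseudoRiemannianMetric

variable (g : PseudoRiemannianMetric I M)

lemma contMDiffAt_val {X Y : Π x : M, TangentSpace I x} {x : M}
    (hX : CMDiffAt ∞ (T% X) x) (hY : CMDiffAt ∞ (T% Y) x) :
    CMDiffAt ∞ (fun y ↦ g.val y (X y) (Y y)) x := by
  have h : ContMDiffAt I (I.prod 𝓘(ℝ)) ∞
      (fun m ↦ TotalSpace.mk' ℝ (E := Bundle.Trivial M ℝ) m (g.val m (X m) (Y m))) x :=
    ContMDiffAt.clm_bundle_apply₂ (F₁ := E) (F₂ := E) g.contMDiff.contMDiffAt hX hY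
  rw [contMDiffAt_totalSpace] at h
  exact h.2

/-- The components of the metric in the coordinate frame of the chart at `x₀`. -/
def inChart (x₀ : M) (y : E) : E →L[ℝ] E →L[ℝ] ℝ :=
  LinearMap.toContinuousBilinearMap (LinearMap.mk₂ ℝ
    (fun u v ↦ g.val ((extChartAt I x₀).symm y) (chartFrame x₀ _ u) (chartFrame x₀ _ v))
    (fun u u' v ↦ by rw [map_add, map_add, add_apply])
    (fun c u v ↦ by rw [map_smul, map_smul, smul_apply])
    (fun u v v' ↦ by rw [map_add, map_add]) (fun c u v ↦ by rw [map_smul, map_smul]))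

lemma inChart_apply (x₀ : M) (y u v : E) : g.inChart x₀ y u v =
    g.val ((extChartAt I x₀).symm y) (chartFrame x₀ _ u) (chartFrame x₀ _ v) := rfl

lemma inChart_extChartAt {x₀ x : M} (hx : x ∈ (extChartAt I x₀).source) (u v : E) :
    g.inChart x₀ (extChartAt I x₀ x) u v =
      g.val x (chartFrame x₀ x u) (chartFrame x₀ x v) := by
  rw [inChart_apply, (extChartAt I x₀).left_inv hx]

lemma inChart_symm (x₀ : M) (y u v : E) : g.inChart x₀ y u v = g.inChart x₀ y v u :=
  g.symm _ _ _

lemma inChart_nondegenerate {x₀ : M} {y : E} (hy : y ∈ (extChartAt I x₀).target) {u : E}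
    (h : ∀ v, g.inChart x₀ y u v = 0) : u = 0 := by
  have hx := (extChartAt I x₀).map_target hy
  have h0 : chartFrame (I := I) x₀ ((extChartAt I x₀).symm y) u = 0 := by
    refine g.nondegenerate _ _ fun v ↦ ?_
    rw [← chartFrame_chartCoframe hx v]
    exact h _
  rw [← chartCoframe_chartFrame hx u, h0, map_zero]

lemma contDiffOn_inChart (x₀ : M) :
    ContDiffOn ℝ ∞ (g.inChart x₀) (extChartAt I x₀).target := by
  rw [contDiffOn_clm_apply]
  intro u
  rw [contDiffOn_clm_apply]
  intro v
  rw [← contMDiffOn_iff_contDiffOn]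
  intro y hy
  have hx := (extChartAt I x₀).map_target hy
  exact (g.contMDiffAt_val (contMDiffAt_chartField_const hx u)
    (contMDiffAt_chartField_const hx v)).comp_contMDiffWithinAt y
    (contMDiffOn_extChartAt_symm x₀ y hy)

lemma contDiffAt_inChart {x₀ : M} {y : E} (hy : y ∈ (extChartAt I x₀).target) :
    ContDiffAt ℝ ∞ (g.inChart x₀) y :=
  (g.contDiffOn_inChart x₀).contDiffAt ((isOpen_extChartAt_target x₀).mem_nhds hy)

lemma differentiableAt_inChart {x₀ : M} {y : E} (hy : y ∈ (extChartAt I x₀).target) :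
    DifferentiableAt ℝ (g.inChart x₀) y :=
  (g.contDiffAt_inChart hy).differentiableAt (by simp)

lemma mvfderiv_val_chartField {x₀ x : M} (hx : x ∈ (extChartAt I x₀).source) {Y Z : E → E}
    (hY : DifferentiableAt ℝ Y (extChartAt I x₀ x))
    (hZ : DifferentiableAt ℝ Z (extChartAt I x₀ x)) (u : E) :
    mvfderiv I (fun x' ↦ g.val x' (chartField x₀ Y x') (chartField x₀ Z x')) x
        (chartFrame x₀ x u) =
      fderiv ℝ (g.inChart x₀) (extChartAt I x₀ x) u (Y (extChartAt I x₀ x))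
          (Z (extChartAt I x₀ x)) +
        g.inChart x₀ (extChartAt I x₀ x) (fderiv ℝ Y (extChartAt I x₀ x) u)
          (Z (extChartAt I x₀ x)) +
        g.inChart x₀ (extChartAt I x₀ x) (Y (extChartAt I x₀ x))
          (fderiv ℝ Z (extChartAt I x₀ x) u) := by
  have hy := (extChartAt I x₀).map_source hx
  rw [mvfderiv_chartFrame hx (g.mdifferentiableAt_val (mdifferentiableAt_chartField hx hY)
    (mdifferentiableAt_chartField hx hZ))]
  have e : (fun x' ↦ g.val x' (chartField x₀ Y x') (chartField x₀ Z x')) ∘ (extChartAt I x₀).symm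
      =ᶠ[𝓝 (extChartAt I x₀ x)] fun y ↦ g.inChart x₀ y (Y y) (Z y) := by
    filter_upwards [(isOpen_extChartAt_target x₀).mem_nhds hy] with y hy
    simp only [Function.comp_apply, chartField, inChart_apply, (extChartAt I x₀).right_inv hy]
  rw [e.fderiv_eq]
  have h := (((g.differentiableAt_inChart hy).hasFDerivAt.clm_apply hY.hasFDerivAt).clm_apply
    hZ.hasFDerivAt).fderiv
  rw [h]
  simp
  ring

lemma koszul_congr {X X' Y Y' Z Z' : Π x : M, TangentSpace I x} {x : M} (hX : X =ᶠ[𝓝 x] X')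
    (hY : Y =ᶠ[𝓝 x] Y') (hZ : Z =ᶠ[𝓝 x] Z') : g.koszul X Y Z x = g.koszul X' Y' Z' x := by
  have key {A A' B B' : Π x : M, TangentSpace I x} (hA : A =ᶠ[𝓝 x] A') (hB : B =ᶠ[𝓝 x] B') :
      mvfderiv I (fun y ↦ g.val y (A y) (B y)) x =
        mvfderiv I (fun y ↦ g.val y (A' y) (B' y)) x := by
    have e : (fun y ↦ g.val y (A y) (B y)) =ᶠ[𝓝 x] fun y ↦ g.val y (A' y) (B' y) := by
      filter_upwards [hA, hB] with y h1 h2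
      rw [h1, h2]
    unfold mvfderiv
    rw [e.mfderiv_eq]
    rfl
  simp only [koszul]
  rw [key hY hZ, key hX hZ, key hX hY, hX.mlieBracket_vectorField_eq hY,
    hX.mlieBracket_vectorField_eq hZ, hY.mlieBracket_vectorField_eq hZ, hX.self_of_nhds,
    hY.self_of_nhds, hZ.self_of_nhds]

lemma koszul_chartField {x₀ x : M} (hx : x ∈ (extChartAt I x₀).source) {Y : E → E}
    (hY : DifferentiableAt ℝ Y (extChartAt I x₀ x)) (u w : E) :
    g.koszul (chartField x₀ fun _ ↦ u) (chartField x₀ Y) (chartField x₀ fun _ ↦ w) x =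
      2 * g.inChart x₀ (extChartAt I x₀ x) (fderiv ℝ Y (extChartAt I x₀ x) u) w +
      (fderiv ℝ (g.inChart x₀) (extChartAt I x₀ x) u (Y (extChartAt I x₀ x)) w +
        fderiv ℝ (g.inChart x₀) (extChartAt I x₀ x) (Y (extChartAt I x₀ x)) u w -
        fderiv ℝ (g.inChart x₀) (extChartAt I x₀ x) w u (Y (extChartAt I x₀ x))) := by
  have hc (v : E) : DifferentiableAt ℝ (fun _ : E ↦ v) (extChartAt I x₀ x) :=
    differentiableAt_const v
  simp only [koszul]
  rw [mlieBracket_chartField hx (hc u) hY, mlieBracket_chartField hx (hc u) (hc w),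
    mlieBracket_chartField hx hY (hc w)]
  have h1 := g.mvfderiv_val_chartField hx hY (hc w) u
  have h2 := g.mvfderiv_val_chartField hx (hc u) (hc w) (Y (extChartAt I x₀ x))
  have h3 := g.mvfderiv_val_chartField hx (hc u) hY w
  simp only [chartField] at h1 h2 h3 ⊢
  rw [h1, h2, h3]
  simp only [← g.inChart_extChartAt hx]
  simp
  rw [g.inChart_symm _ _ u]
  ring

/-- The Levi-Civita connection in a chart, for Christoffel symbols given by the lowered formula. -/
lemma leviCivita_chartField {x₀ x : M} (hx : x ∈ (extChartAt I x₀).source) {Y : E → E}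
    (hY : DifferentiableAt ℝ Y (extChartAt I x₀ x)) (u : E)
    {X' Y' : Π x : M, TangentSpace I x} (hX' : X' =ᶠ[𝓝 x] chartField (I := I) (E := E) x₀ fun _ ↦ u)
    (hY' : Y' =ᶠ[𝓝 x] chartField (I := I) x₀ Y) {Γ : E}
    (hΓ : ∀ w, 2 * g.inChart x₀ (extChartAt I x₀ x) Γ w =
      fderiv ℝ (g.inChart x₀) (extChartAt I x₀ x) u (Y (extChartAt I x₀ x)) w +
        fderiv ℝ (g.inChart x₀) (extChartAt I x₀ x) (Y (extChartAt I x₀ x)) u w -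
        fderiv ℝ (g.inChart x₀) (extChartAt I x₀ x) w u (Y (extChartAt I x₀ x))) :
    g.leviCivita X' Y' x = chartFrame x₀ x (fderiv ℝ Y (extChartAt I x₀ x) u + Γ) := by
  have hc (v : E) : MDiffAt (T% (chartField (I := I) x₀ fun _ : E ↦ v)) x :=
    mdifferentiableAt_chartField hx (differentiableAt_const v)
  have hX : MDiffAt (T% X') x := (hc u).congr_of_eventuallyEq <| by
    filter_upwards [hX'] with z hz
    rw [hz]
  have hYY : MDiffAt (T% Y') x := (mdifferentiableAt_chartField hx hY).congr_of_eventuallyEq <| by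
    filter_upwards [hY'] with z hz
    rw [hz]
  rw [← sub_eq_zero]
  refine g.nondegenerate x _ fun v ↦ ?_
  rw [← chartFrame_chartCoframe (I := I) hx v]
  set w := chartCoframe (I := I) x₀ x v
  have h1 := g.two_mul_val_leviCivita hX hYY (hc w)
  rw [g.koszul_congr hX' hY' (EventuallyEq.refl _ (chartField x₀ fun _ : E ↦ w)),
    g.koszul_chartField hx hY, ← hΓ] at h1
  simp only [chartField] at h1
  rw [map_sub, sub_apply, ← g.inChart_extChartAt hx, map_add,
    add_apply]
  linarith

end PseudoRiemannianMetric

end MetricInChart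

section Curvature

variable {E : Type*} [NormedAddCommGroup E] [NormedSpace ℝ E]

/-- The map `w ↦ R(u, w) v` of the connection on `E` with coefficients `S`. -/
def curvatureMap (S : E → E →L[ℝ] E →L[ℝ] E) (y u v : E) : E →L[ℝ] E :=
  (fderiv ℝ S y u).flip v + (S y u).comp ((S y).flip v) -
    (((fderiv ℝ S y).flip u).flip v) - (S y).flip (S y u v)

lemma curvatureMap_apply (S : E → E →L[ℝ] E →L[ℝ] E) (y u v w : E) :
    curvatureMap S y u v w = fderiv ℝ S y u w v + S y u (S y w v) - fderiv ℝ S y w u v -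
      S y w (S y u v) := by
  simp [curvatureMap]

end Curvature

section ConnectionCoeff

variable {E : Type*} [NormedAddCommGroup E] [NormedSpace ℝ E]

/-- The lowered coefficients of the semi-symmetric metric connection of the metric `G` on an open
subset of `E`, with generating vector field `Q`. -/
def loweredCoeff (G : E → E →L[ℝ] E →L[ℝ] ℝ) (Q : E → E) (y u v : E) : E →L[ℝ] ℝ :=
  (1 / 2 : ℝ) • (fderiv ℝ G y u v + fderiv ℝ G y v u - ((fderiv ℝ G y).flip u).flip v) +
    (G y v (Q y) • G y u - G y u v • G y (Q y))

variable (G : E → E →L[ℝ] E →L[ℝ] ℝ) (Q : E → E) (y u u' v v' w : E) (c : ℝ)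

lemma loweredCoeff_apply : loweredCoeff G Q y u v w =
      1 / 2 * (fderiv ℝ G y u v w + fderiv ℝ G y v u w - fderiv ℝ G y w u v) +
      (G y v (Q y) * G y u w - G y u v * G y (Q y) w) := rfl

lemma loweredCoeff_add_left :
    loweredCoeff G Q y (u + u') v = loweredCoeff G Q y u v + loweredCoeff G Q y u' v := by
  ext w
  rw [add_apply]
  simp only [loweredCoeff_apply, map_add, add_apply]
  ring

lemma loweredCoeff_smul_left :
    loweredCoeff G Q y (c • u) v = c • loweredCoeff G Q y u v := by
  ext w
  rw [smul_apply]
  simp only [loweredCoeff_apply, map_smul, smul_apply, smul_eq_mul]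
  ring

lemma loweredCoeff_add_right :
    loweredCoeff G Q y u (v + v') = loweredCoeff G Q y u v + loweredCoeff G Q y u v' := by
  ext w
  rw [add_apply]
  simp only [loweredCoeff_apply, map_add, add_apply]
  ring

lemma loweredCoeff_smul_right :
    loweredCoeff G Q y u (c • v) = c • loweredCoeff G Q y u v := by
  ext w
  rw [smul_apply]
  simp only [loweredCoeff_apply, map_smul, smul_apply, smul_eq_mul]
  ring

variable [FiniteDimensional ℝ E]

/-- The coefficients of the semi-symmetric metric connection of the metric `G` on an open
subset of `E`, with generating vector field `Q`. -/
def connectionCoeff (y : E) : E →L[ℝ] E →L[ℝ] E :=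
  LinearMap.toContinuousBilinearMap (LinearMap.mk₂ ℝ
    (fun u v ↦ (G y).inverse (loweredCoeff G Q y u v))
    (fun u u' v ↦ by rw [loweredCoeff_add_left, map_add])
    (fun c u v ↦ by rw [loweredCoeff_smul_left, map_smul])
    (fun u v v' ↦ by rw [loweredCoeff_add_right, map_add])
    (fun c u v ↦ by rw [loweredCoeff_smul_right, map_smul]))

lemma connectionCoeff_apply :
    connectionCoeff G Q y u v = (G y).inverse (loweredCoeff G Q y u v) := rfl

variable {G Q y}

lemma apply_connectionCoeff (hy : (G y).IsInvertible) :
    G y (connectionCoeff G Q y u v) = loweredCoeff G Q y u v := by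
  rw [connectionCoeff_apply, hy.self_apply_inverse]

lemma contDiffAt_loweredCoeff (hG : ContDiffAt ℝ ∞ G y) (hQ : ContDiffAt ℝ ∞ Q y) :
    ContDiffAt ℝ ∞ (fun y ↦ loweredCoeff G Q y u v) y := by
  have hD : ContDiffAt ℝ ∞ (fderiv ℝ G) y := hG.fderiv_right (by simp)
  have hflip : ContDiffAt ℝ ∞ (fun y ↦ ((fderiv ℝ G y).flip u).flip v) y := by
    have h1 : ContDiffAt ℝ ∞ (fun y ↦ (fderiv ℝ G y).flip u) y :=
      ContDiffAt.clm_apply ((ContinuousLinearMap.flipₗᵢ ℝ E E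
        (E →L[ℝ] ℝ)).toContinuousLinearEquiv.contDiff.contDiffAt.comp y hD) contDiffAt_const
    exact ContDiffAt.clm_apply ((ContinuousLinearMap.flipₗᵢ ℝ E E
        ℝ).toContinuousLinearEquiv.contDiff.contDiffAt.comp y h1) contDiffAt_const
  have h1 (a b : E) : ContDiffAt ℝ ∞ (fun y ↦ fderiv ℝ G y a b) y :=
    (hD.clm_apply contDiffAt_const).clm_apply contDiffAt_const
  have h2 (a : E) : ContDiffAt ℝ ∞ (fun y ↦ G y a) y := hG.clm_apply contDiffAt_const
  exact ((((h1 u v).add (h1 v u)).sub hflip).const_smul (1 / 2 : ℝ)).add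
    ((((h2 v).clm_apply hQ).smul (h2 u)).sub
      (((h2 u).clm_apply contDiffAt_const).smul (hG.clm_apply hQ)))

lemma contDiffOn_connectionCoeff {s : Set E} (hs : IsOpen s) (hG : ContDiffOn ℝ ∞ G s)
    (hG' : ∀ y ∈ s, (G y).IsInvertible) (hQ : ContDiffOn ℝ ∞ Q s) :
    ContDiffOn ℝ ∞ (connectionCoeff G Q) s := by
  rw [contDiffOn_clm_apply]
  intro u
  rw [contDiffOn_clm_apply]
  intro v y hy
  refine ContDiffAt.contDiffWithinAt ?_
  have hGy := hG.contDiffAt (hs.mem_nhds hy)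
  exact ((hG' y hy).contDiffAt_map_inverse.comp y hGy).clm_apply
    (contDiffAt_loweredCoeff u v hGy (hQ.contDiffAt (hs.mem_nhds hy)))

end ConnectionCoeff

section ConnectionInChart

variable {E : Type*} [NormedAddCommGroup E] [NormedSpace ℝ E] [FiniteDimensional ℝ E]
  {H : Type*} [TopologicalSpace H] {I : ModelWithCorners ℝ E H} [I.Boundaryless]
  {M : Type*} [TopologicalSpace M] [ChartedSpace H M] [IsManifold I ∞ M]

namespace PseudoRiemannianMetric

variable (g : PseudoRiemannianMetric I M)

lemma isInvertible_inChart {x₀ : M} {y : E} (hy : y ∈ (extChartAt I x₀).target) :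
    (g.inChart x₀ y).IsInvertible := by
  have hf : Module.finrank ℝ E = Module.finrank ℝ (E →L[ℝ] ℝ) := by
    rw [← LinearEquiv.finrank_eq (LinearMap.toContinuousLinearMap (𝕜 := ℝ) (E := E) (F' := ℝ))]
    exact Subspace.dual_finrank_eq.symm
  let e := LinearEquiv.ofInjectiveOfFinrankEq (g.inChart x₀ y).toLinearMap (by
    rw [← LinearMap.ker_eq_bot, LinearMap.ker_eq_bot']
    intro u hu
    exact g.inChart_nondegenerate hy fun v ↦ by simpa using congrArg (fun L ↦ L v) hu) hf
  refine ⟨e.toContinuousLinearEquiv, ?_⟩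
  ext u v
  rfl

/-- The semi-symmetric metric connection in a chart. -/
lemma semiSymmetricConnection_chartField {x₀ x : M} (hx : x ∈ (extChartAt I x₀).source)
    {Q : E → E} {P : Π x : M, TangentSpace I x}
    (hP : P x = chartField x₀ Q x) {Y : E → E}
    (hY : DifferentiableAt ℝ Y (extChartAt I x₀ x)) (u : E)
    {X' Y' : Π x : M, TangentSpace I x} (hX' : X' =ᶠ[𝓝 x] chartField (I := I) (E := E) x₀ fun _ ↦ u)
    (hY' : Y' =ᶠ[𝓝 x] chartField (I := I) x₀ Y) :
    g.semiSymmetricConnection P X' Y' x =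
      chartField x₀ (fun y ↦ fderiv ℝ Y y u + connectionCoeff (g.inChart x₀) Q y u (Y y)) x := by
  have hy := (extChartAt I x₀).map_source hx
  set y := extChartAt I x₀ x with hy_def
  rw [semiSymmetricConnection, g.leviCivita_chartField hx hY u hX' hY' (Γ :=
    connectionCoeff (g.inChart x₀) Q y u (Y y) -
      (g.inChart x₀ y (Y y) (Q y) • u - g.inChart x₀ y u (Y y) • Q y)),
    hP, hX'.self_of_nhds, hY'.self_of_nhds]
  · simp only [chartField, ← hy_def]
    rw [← g.inChart_extChartAt hx, ← g.inChart_extChartAt hx]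
    simp only [map_add, map_sub, map_smul]
    abel
  · intro w
    rw [map_sub, apply_connectionCoeff _ _ (g.isInvertible_inChart hy)]
    simp only [loweredCoeff_apply, map_sub, map_smul, sub_apply, smul_apply, smul_eq_mul]
    ring

lemma extend_eventuallyEq_chartField {x₀ x : M} (hx : x ∈ (extChartAt I x₀).source)
    (u : TangentSpace I x₀) :
    (FiberBundle.extend E u : Π x : M, TangentSpace I x) =ᶠ[𝓝 x]
      chartField (I := I) (E := E) x₀ (fun _ ↦ u) := by
  filter_upwards [eventually_mem_chart_source x₀ hx] with x' hx'
  exact extend_eq_chartField hx' u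

lemma curvatureOf_semiSymmetricConnection (x₀ : M)
    {Q : E → E} (hQ : ContDiffOn ℝ ∞ Q (extChartAt I x₀).target) {P : Π x : M, TangentSpace I x}
    (hP : ∀ x ∈ (extChartAt I x₀).source, P x = chartField x₀ Q x) {u v w : E}
    {U V W : Π x : M, TangentSpace I x}
    (hU : ∀ x ∈ (extChartAt I x₀).source, U =ᶠ[𝓝 x] chartField (I := I) x₀ (fun _ ↦ u))
    (hV : ∀ x ∈ (extChartAt I x₀).source, V =ᶠ[𝓝 x] chartField (I := I) x₀ (fun _ ↦ v))
    (hW : ∀ x ∈ (extChartAt I x₀).source, W =ᶠ[𝓝 x] chartField (I := I) x₀ (fun _ ↦ w)) :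
    curvatureOf (g.semiSymmetricConnection P) U W V x₀ =
    curvatureMap (connectionCoeff (g.inChart x₀) Q) (extChartAt I x₀ x₀) u v w := by
  have hx₀ := mem_extChartAt_source (I := I) x₀
  have hev := eventually_mem_chart_source (I := I) x₀ hx₀
  set y₀ := extChartAt I x₀ x₀ with hy₀
  have hS : DifferentiableAt ℝ (connectionCoeff (g.inChart x₀) Q) y₀ :=
    ((contDiffOn_connectionCoeff (isOpen_extChartAt_target x₀) (g.contDiffOn_inChart x₀)
      (fun _ ↦ g.isInvertible_inChart) hQ).contDiffAt ((isOpen_extChartAt_target x₀).mem_nhds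
      (mem_extChartAt_target x₀))).differentiableAt (by simp)
  have h1 {a b : E} {A B : Π x : M, TangentSpace I x}
      (hA : ∀ x ∈ (extChartAt I x₀).source, A =ᶠ[𝓝 x] chartField (I := I) x₀ (fun _ ↦ a))
      (hB : ∀ x ∈ (extChartAt I x₀).source, B =ᶠ[𝓝 x] chartField (I := I) x₀ (fun _ ↦ b)) :
      g.semiSymmetricConnection P A B =ᶠ[𝓝 x₀]
        chartField (I := I) x₀ (fun y ↦ connectionCoeff (g.inChart x₀) Q y a b) := by
    filter_upwards [hev] with x hx
    rw [g.semiSymmetricConnection_chartField hx (hP x hx) (differentiableAt_const b) a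
      (hA x hx) (hB x hx)]
    simp [chartField]
    rfl
  have h2 {a b c : E} {A B C : Π x : M, TangentSpace I x}
      (hA : ∀ x ∈ (extChartAt I x₀).source, A =ᶠ[𝓝 x] chartField (I := I) x₀ (fun _ ↦ a))
      (hB : ∀ x ∈ (extChartAt I x₀).source, B =ᶠ[𝓝 x] chartField (I := I) x₀ (fun _ ↦ b))
      (hC : ∀ x ∈ (extChartAt I x₀).source, C =ᶠ[𝓝 x] chartField (I := I) x₀ (fun _ ↦ c)) :
      g.semiSymmetricConnection P A (g.semiSymmetricConnection P B C) x₀ =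
      (fderiv ℝ (connectionCoeff (g.inChart x₀) Q) y₀ a b c +
        connectionCoeff (g.inChart x₀) Q y₀ a (connectionCoeff (g.inChart x₀) Q y₀ b c) : E) := by
    rw [g.semiSymmetricConnection_chartField hx₀ (hP x₀ hx₀)
      ((hS.clm_apply (differentiableAt_const b)).clm_apply
        (differentiableAt_const c)) a (hA x₀ hx₀) (h1 hB hC)]
    simp only [chartField, chartFrame_self, ← hy₀]
    rw [((hS.hasFDerivAt.clm_apply (hasFDerivAt_const b _)).clm_apply
        (hasFDerivAt_const c _)).fderiv]
    simp
    rfl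
  have h3 : g.semiSymmetricConnection P (VectorField.mlieBracket I U W) V x₀ = 0 := by
    have h0 : VectorField.mlieBracket I U W =ᶠ[𝓝 x₀] chartField (I := I) x₀ (fun _ : E ↦ 0) := by
      filter_upwards [hev] with x hx
      rw [(hU x hx).mlieBracket_vectorField_eq (hW x hx),
        mlieBracket_chartField hx (differentiableAt_const u) (differentiableAt_const w)]
      simp [chartField]
      rfl
    rw [g.semiSymmetricConnection_chartField hx₀ (hP x₀ hx₀) (differentiableAt_const v) 0 h0
      (hV x₀ hx₀)]
    simp [chartField]
  simp only [curvatureOf, Pi.sub_apply]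
  rw [h2 hU hW hV, h2 hW hU hV, h3, curvatureMap_apply, sub_zero]
  exact (fun a b c d : E ↦ (by abel : a + b - (c + d) = a + b - c - d)) _ _ _ _

lemma ricciOf_semiSymmetricConnection (x₀ : M)
    {Q : E → E} (hQ : ContDiffOn ℝ ∞ Q (extChartAt I x₀).target) {P : Π x : M, TangentSpace I x}
    (hP : ∀ x ∈ (extChartAt I x₀).source, P x = chartField x₀ Q x) (u v : TangentSpace I x₀) :
    ricciOf (g.semiSymmetricConnection P) x₀ u v =
    LinearMap.trace ℝ E (curvatureMap (connectionCoeff (g.inChart x₀) Q)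
      (extChartAt I x₀ x₀) u v).toLinearMap := by
  rw [LinearMap.trace_eq_matrix_trace ℝ (Module.finBasis ℝ E), Matrix.trace]
  refine Finset.sum_congr rfl fun k _ ↦ ?_
  have h := g.curvatureOf_semiSymmetricConnection x₀ hQ hP
    (fun x hx ↦ extend_eventuallyEq_chartField hx u)
    (fun x hx ↦ extend_eventuallyEq_chartField hx v)
    (fun x hx ↦ extend_eventuallyEq_chartField hx
      (Module.finBasis ℝ (TangentSpace I x₀) k))
  refine (congrArg ((Module.finBasis ℝ (TangentSpace I x₀)).coord k) h).trans ?_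
  exact (LinearMap.toMatrix_apply (Module.finBasis ℝ E) (Module.finBasis ℝ E)
    (curvatureMap (connectionCoeff (g.inChart x₀) Q) (extChartAt I x₀ x₀) u v).toLinearMap
    k k).symm

end PseudoRiemannianMetric

end ConnectionInChart

section BlockTrace

variable {EB : Type*} [AddCommGroup EB] [Module ℝ EB] [FiniteDimensional ℝ EB]
  {ι : Type*} [Fintype ι] [DecidableEq ι] {EF : ι → Type*} [∀ i, AddCommGroup (EF i)]
  [∀ i, Module ℝ (EF i)] [∀ i, FiniteDimensional ℝ (EF i)]

/-- The trace on a product is the sum of the traces of the diagonal blocks. -/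
lemma trace_prod_pi (L : (EB × ∀ i, EF i) →ₗ[ℝ] (EB × ∀ i, EF i)) :
    LinearMap.trace ℝ _ L =
      LinearMap.trace ℝ EB (LinearMap.fst ℝ EB _ ∘ₗ L ∘ₗ LinearMap.inl ℝ EB _) +
      ∑ j, LinearMap.trace ℝ (EF j) ((LinearMap.proj j ∘ₗ LinearMap.snd ℝ EB _) ∘ₗ L ∘ₗ
        (LinearMap.inr ℝ EB _ ∘ₗ LinearMap.single ℝ EF j)) := by
  have h : L = L ∘ₗ (LinearMap.inl ℝ EB _ ∘ₗ LinearMap.fst ℝ EB _) +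
      ∑ j, L ∘ₗ ((LinearMap.inr ℝ EB _ ∘ₗ LinearMap.single ℝ EF j) ∘ₗ
        (LinearMap.proj j ∘ₗ LinearMap.snd ℝ EB _)) := by
    have e : LinearMap.id = (LinearMap.inl ℝ EB (∀ i, EF i) ∘ₗ LinearMap.fst ℝ EB _) +
      ∑ j, ((LinearMap.inr ℝ EB _ ∘ₗ LinearMap.single ℝ EF j) ∘ₗ
        (LinearMap.proj j ∘ₗ LinearMap.snd ℝ EB _)) := by
      refine LinearMap.ext fun x ↦ Prod.ext ?_ ?_
      · simp [Prod.fst_sum]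
      · simp [Prod.snd_sum, Finset.univ_sum_single]
    conv_lhs => rw [← LinearMap.comp_id L, e, LinearMap.comp_add]
    congr 1
    refine LinearMap.ext fun x ↦ ?_
    simp
  conv_lhs => rw [h]
  rw [map_add, map_sum]
  congr 1
  · rw [← LinearMap.comp_assoc, LinearMap.trace_comp_comm']
  · refine Finset.sum_congr rfl fun j _ ↦ ?_
    rw [← LinearMap.comp_assoc, LinearMap.trace_comp_comm']

end BlockTrace

section FiberTrace

variable {V : Type*} [AddCommGroup V] [Module ℝ V] [FiniteDimensional ℝ V]

lemma trace_smul_id_sub_smulRight (L : V →ₗ[ℝ] V) (a : ℝ) (φ : V →ₗ[ℝ] ℝ) (x : V)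
    (hL : ∀ w, L w = a • w - φ w • x) :
    LinearMap.trace ℝ V L = Module.finrank ℝ V * a - φ x := by
  have : L = a • LinearMap.id - φ.smulRight x := by
    ext w
    simp [hL]
  rw [this, map_sub, map_smul, LinearMap.trace_id, LinearMap.trace_smulRight, smul_eq_mul, mul_comm]

lemma trace_of_lowered (g : V →ₗ[ℝ] V →ₗ[ℝ] ℝ) (hs : ∀ u v, g u v = g v u)
    (hn : ∀ u, (∀ v, g u v = 0) → u = 0) (L : V →ₗ[ℝ] V) (α : V →ₗ[ℝ] ℝ) (v : V)
    (hL : ∀ w z, g (L w) z = α v * g w z - α z * g w v) :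
    LinearMap.trace ℝ V L = (Module.finrank ℝ V - 1) * α v := by
  have hinj : Function.Injective g := by
    rw [← LinearMap.ker_eq_bot, LinearMap.ker_eq_bot']
    intro u hu
    exact hn u fun v ↦ by rw [hu]; rfl
  obtain ⟨a, ha⟩ := (LinearMap.injective_iff_surjective_of_finrank_eq_finrank
    (Subspace.dual_finrank_eq (K := ℝ) (V := V)).symm).1 hinj α
  rw [trace_smul_id_sub_smulRight L (α v) (g v) a fun w ↦ ?_]
  · rw [hs v a, ha]
    ring
  · rw [← sub_eq_zero]
    refine hn _ fun z ↦ ?_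
    rw [map_sub, LinearMap.sub_apply, hL, map_sub, map_smul, map_smul, LinearMap.sub_apply,
      LinearMap.smul_apply, LinearMap.smul_apply, ha, hs v w, smul_eq_mul, smul_eq_mul]
    ring

end FiberTrace

section TwistedCoefficients

variable {EB : Type*} [NormedAddCommGroup EB] [NormedSpace ℝ EB] [FiniteDimensional ℝ EB]
  {ι : Type*} [Fintype ι] {EF : ι → Type*} [∀ i, NormedAddCommGroup (EF i)]
  [∀ i, NormedSpace ℝ (EF i)] [∀ i, FiniteDimensional ℝ (EF i)]

variable (EB EF) in
/-- The projection of the product onto the base and the `i`-th fibre. -/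
def pairProj (i : ι) : (EB × ∀ i, EF i) →L[ℝ] EB × EF i :=
  (ContinuousLinearMap.fst ℝ EB _).prod
    ((ContinuousLinearMap.proj (R := ℝ) (φ := EF) i).comp (ContinuousLinearMap.snd ℝ EB _))

lemma pairProj_apply (i : ι) (y : EB × ∀ i, EF i) : pairProj EB EF i y = (y.1, y.2 i) := rfl

/-- `S` are the coefficients at `y` of the semi-symmetric metric connection of a multiply twisted
product metric with twisting functions `exp (β i)`; they are given by their lowered components. -/
structure IsTwistedCoeffAt (S : (EB × ∀ i, EF i) →L[ℝ] (EB × ∀ i, EF i) →L[ℝ] (EB × ∀ i, EF i))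
    (y : EB × ∀ i, EF i) (β : ∀ i, EB × EF i → ℝ) (gB : EB → EB →L[ℝ] EB →L[ℝ] ℝ)
    (gF : ∀ i, EF i → EF i →L[ℝ] EF i →L[ℝ] ℝ) (θ : EB → EB →L[ℝ] ℝ)
    (κB : EB → EB → EB → EB → ℝ) (κF : ∀ i, EF i → EF i → EF i → EF i → ℝ)
    (c : ι → (EB × ∀ i, EF i) → EB → ℝ) : Prop where
  nondegenerate_base (u : EB) : (∀ v, gB y.1 u v = 0) → u = 0
  nondegenerate_fiber i (u : EF i) : (∀ v, gF i (y.2 i) u v = 0) → u = 0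
  symm_fiber i (u v : EF i) : gF i (y.2 i) u v = gF i (y.2 i) v u
  fiberCoeff_zero i (v w : EF i) : κF i (y.2 i) 0 v w = 0
  fiberCoeff_symm i (u v w : EF i) : κF i (y.2 i) u v w = κF i (y.2 i) v u w
  baseCoeff_zero_left (v w : EB) : κB y.1 0 v w = 0
  baseCoeff_zero_right (v w : EB) : κB y.1 v 0 w = 0
  fiber i u v w : gF i (y.2 i) ((S u v).2 i) w =
    fderiv ℝ (β i) (pairProj EB EF i y) (pairProj EB EF i u) * gF i (y.2 i) (v.2 i) w +
    fderiv ℝ (β i) (pairProj EB EF i y) (pairProj EB EF i v) * gF i (y.2 i) (u.2 i) w -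
    fderiv ℝ (β i) (pairProj EB EF i y) (0, w) * gF i (y.2 i) (u.2 i) (v.2 i) +
    κF i (y.2 i) (u.2 i) (v.2 i) w + θ y.1 v.1 * gF i (y.2 i) (u.2 i) w
  base u v w : gB y.1 (S u v).1 w =
    κB y.1 u.1 v.1 w - ∑ i, c i y w * gF i (y.2 i) (u.2 i) (v.2 i)

/-- `S` are, near `y₀`, the coefficients of the semi-symmetric metric connection of a multiply
twisted product metric. -/
structure IsTwistedCoeff
    (S : (EB × ∀ i, EF i) → (EB × ∀ i, EF i) →L[ℝ] (EB × ∀ i, EF i) →L[ℝ] (EB × ∀ i, EF i))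
    (y₀ : EB × ∀ i, EF i) (β : ∀ i, EB × EF i → ℝ) (gB : EB → EB →L[ℝ] EB →L[ℝ] ℝ)
    (gF : ∀ i, EF i → EF i →L[ℝ] EF i →L[ℝ] ℝ) (θ : EB → EB →L[ℝ] ℝ)
    (κB : EB → EB → EB → EB → ℝ) (κF : ∀ i, EF i → EF i → EF i → EF i → ℝ)
    (c : ι → (EB × ∀ i, EF i) → EB → ℝ) : Prop where
  differentiableAt : DifferentiableAt ℝ S y₀
  contDiffAt i : ContDiffAt ℝ ∞ (β i) (pairProj EB EF i y₀)
  differentiableAt_form : DifferentiableAt ℝ θ y₀.1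
  eventually : ∀ᶠ y in 𝓝 y₀, IsTwistedCoeffAt (S y) y β gB gF θ κB κF c

variable [DecidableEq ι]

variable (EF) in
/-- A base vector. -/
def baseVec (X : EB) : EB × ∀ i, EF i := (X, 0)

variable (EB) in
/-- A vector of the `i`-th fibre. -/
def fiberVec (i : ι) (v : EF i) : EB × ∀ i, EF i := (0, Pi.single i v)

@[simp] lemma baseVec_fst (X : EB) : (baseVec EF X).1 = X := rfl
@[simp] lemma baseVec_snd (X : EB) (i : ι) : (baseVec EF X).2 i = 0 := rfl
@[simp] lemma fiberVec_fst (i : ι) (v : EF i) : (fiberVec EB i v).1 = 0 := rfl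
@[simp] lemma fiberVec_snd_same (i : ι) (v : EF i) : (fiberVec EB i v).2 i = v :=
  Pi.single_eq_same _ _
lemma fiberVec_snd_ne {i j : ι} (h : j ≠ i) (v : EF i) : (fiberVec EB i v).2 j = 0 :=
  Pi.single_eq_of_ne h _
@[simp] lemma pairProj_baseVec (i : ι) (X : EB) : pairProj EB EF i (baseVec EF X) = (X, 0) := rfl
@[simp] lemma pairProj_fiberVec_same (i : ι) (v : EF i) :
    pairProj EB EF i (fiberVec EB i v) = (0, v) := by
  rw [pairProj_apply, fiberVec_fst, fiberVec_snd_same]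
lemma pairProj_fiberVec_ne {i j : ι} (h : j ≠ i) (v : EF i) :
    pairProj EB EF j (fiberVec EB i v) = 0 := by
  rw [pairProj_apply, fiberVec_fst, fiberVec_snd_ne h]
  rfl

variable {β : ∀ i, EB × EF i → ℝ} {gB : EB → EB →L[ℝ] EB →L[ℝ] ℝ}
  {gF : ∀ i, EF i → EF i →L[ℝ] EF i →L[ℝ] ℝ} {θ : EB → EB →L[ℝ] ℝ}
  {κB : EB → EB → EB → EB → ℝ} {κF : ∀ i, EF i → EF i → EF i → EF i → ℝ}
  {c : ι → (EB × ∀ i, EF i) → EB → ℝ}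

namespace IsTwistedCoeffAt

variable {S : (EB × ∀ i, EF i) →L[ℝ] (EB × ∀ i, EF i) →L[ℝ] (EB × ∀ i, EF i)}
  {y : EB × ∀ i, EF i}

lemma fiberCoeff_zero' (h : IsTwistedCoeffAt S y β gB gF θ κB κF c) (i : ι) (v w : EF i) :
    κF i (y.2 i) v 0 w = 0 := by
  rw [h.fiberCoeff_symm, h.fiberCoeff_zero]

lemma fiber_ext (h : IsTwistedCoeffAt S y β gB gF θ κB κF c) {i : ι} {u v : EF i}
    (huv : ∀ w, gF i (y.2 i) u w = gF i (y.2 i) v w) : u = v := by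
  rw [← sub_eq_zero]
  refine h.nondegenerate_fiber i _ fun w ↦ ?_
  rw [map_sub, sub_apply, huv, sub_self]

lemma base_ext (h : IsTwistedCoeffAt S y β gB gF θ κB κF c) {u v : EB}
    (huv : ∀ w, gB y.1 u w = gB y.1 v w) : u = v := by
  rw [← sub_eq_zero]
  refine h.nondegenerate_base _ fun w ↦ ?_
  rw [map_sub, sub_apply, huv, sub_self]

lemma baseVec_apply_snd (h : IsTwistedCoeffAt S y β gB gF θ κB κF c) (X : EB)
    (v : EB × ∀ i, EF i) (i : ι) :
    (S (baseVec EF X) v).2 i = fderiv ℝ (β i) (pairProj EB EF i y) (X, 0) • v.2 i := by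
  refine h.fiber_ext fun w ↦ ?_
  rw [h.fiber]
  simp [h.fiberCoeff_zero]

lemma apply_baseVec_snd (h : IsTwistedCoeffAt S y β gB gF θ κB κF c) (X : EB)
    (v : EB × ∀ i, EF i) (i : ι) : (S v (baseVec EF X)).2 i =
      (fderiv ℝ (β i) (pairProj EB EF i y) (X, 0) + θ y.1 X) • v.2 i := by
  refine h.fiber_ext fun w ↦ ?_
  rw [h.fiber]
  simp [h.fiberCoeff_zero']
  ring

lemma baseVec_apply_fst (h : IsTwistedCoeffAt S y β gB gF θ κB κF c) (X : EB)
    {v : EB × ∀ i, EF i} (hv : v.1 = 0) : (S (baseVec EF X) v).1 = 0 := by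
  refine h.base_ext fun w ↦ ?_
  rw [h.base]
  simp [hv, h.baseCoeff_zero_right]

lemma apply_baseVec_fst (h : IsTwistedCoeffAt S y β gB gF θ κB κF c) (X : EB)
    {v : EB × ∀ i, EF i} (hv : v.1 = 0) : (S v (baseVec EF X)).1 = 0 := by
  refine h.base_ext fun w ↦ ?_
  rw [h.base]
  simp [hv, h.baseCoeff_zero_left]

lemma baseVec_apply_fiberVec (h : IsTwistedCoeffAt S y β gB gF θ κB κF c) (X : EB) (i : ι)
    (v : EF i) : S (baseVec EF X) (fiberVec EB i v) =
      fderiv ℝ (β i) (pairProj EB EF i y) (X, 0) • fiberVec EB i v := by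
  refine Prod.ext ?_ (funext fun j ↦ ?_)
  · rw [h.baseVec_apply_fst X rfl, Prod.smul_fst, fiberVec_fst, smul_zero]
  · rw [h.baseVec_apply_snd, Prod.smul_snd, Pi.smul_apply]
    obtain rfl | hj := eq_or_ne j i
    · rfl
    · rw [fiberVec_snd_ne hj, smul_zero, smul_zero]

lemma fiberVec_apply_baseVec (h : IsTwistedCoeffAt S y β gB gF θ κB κF c) (X : EB) (i : ι)
    (v : EF i) : S (fiberVec EB i v) (baseVec EF X) =
      (fderiv ℝ (β i) (pairProj EB EF i y) (X, 0) + θ y.1 X) • fiberVec EB i v := by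
  refine Prod.ext ?_ (funext fun j ↦ ?_)
  · rw [h.apply_baseVec_fst X rfl, Prod.smul_fst, fiberVec_fst, smul_zero]
  · rw [h.apply_baseVec_snd, Prod.smul_snd, Pi.smul_apply]
    obtain rfl | hj := eq_or_ne j i
    · rfl
    · rw [fiberVec_snd_ne hj, smul_zero, smul_zero]

lemma baseVec_apply_baseVec (h : IsTwistedCoeffAt S y β gB gF θ κB κF c) (X Y : EB) :
    S (baseVec EF X) (baseVec EF Y) = baseVec EF (S (baseVec EF X) (baseVec EF Y)).1 := by
  refine Prod.ext rfl (funext fun j ↦ ?_)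
  rw [h.baseVec_apply_snd, baseVec_snd, baseVec_snd, smul_zero]

lemma fiberVec_apply_snd_of_ne (h : IsTwistedCoeffAt S y β gB gF θ κB κF c) {i j : ι}
    (hij : j ≠ i) (w : EF j) (v : EF i) :
    (S (fiberVec EB j w) (fiberVec EB i v)).2 j = 0 := by
  refine h.fiber_ext fun z ↦ ?_
  rw [h.fiber, fiberVec_snd_ne hij, pairProj_fiberVec_ne hij]
  simp [h.fiberCoeff_zero']

lemma fiberVec_apply_snd_of_ne' (h : IsTwistedCoeffAt S y β gB gF θ κB κF c) {i j : ι}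
    (hij : j ≠ i) (w : EF j) (v : EF i) :
    (S (fiberVec EB i v) (fiberVec EB j w)).2 j = 0 := by
  refine h.fiber_ext fun z ↦ ?_
  rw [h.fiber, fiberVec_snd_ne hij, pairProj_fiberVec_ne hij]
  simp [h.fiberCoeff_zero]

lemma fiberVec_apply_snd_comm (h : IsTwistedCoeffAt S y β gB gF θ κB κF c) (i : ι)
    (v w : EF i) :
    (S (fiberVec EB i v) (fiberVec EB i w)).2 i = (S (fiberVec EB i w) (fiberVec EB i v)).2 i := by
  refine h.fiber_ext fun z ↦ ?_
  rw [h.fiber, h.fiber, fiberVec_snd_same, fiberVec_snd_same, h.symm_fiber i v w,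
    h.fiberCoeff_symm i v w, fiberVec_fst, fiberVec_fst]
  simp
  ring

end IsTwistedCoeffAt

lemma hasFDerivAt_fderiv_pairProj {y₀ : EB × ∀ i, EF i} {i : ι} {f : EB × EF i → ℝ}
    (hf : ContDiffAt ℝ ∞ f (pairProj EB EF i y₀)) (u : EB × EF i) :
    HasFDerivAt (fun y ↦ fderiv ℝ f (pairProj EB EF i y) u)
      (((fderiv ℝ (fderiv ℝ f) (pairProj EB EF i y₀)).flip u).comp (pairProj EB EF i)) y₀ := by
  have h1 : HasFDerivAt (fderiv ℝ f) _ (pairProj EB EF i y₀) :=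
    ((hf.fderiv_right (m := ∞) (by simp)).differentiableAt (by simp)).hasFDerivAt
  have h2 := (h1.comp y₀ (pairProj EB EF i).hasFDerivAt).clm_apply (hasFDerivAt_const u y₀)
  refine h2.congr_fderiv (ContinuousLinearMap.ext fun w ↦ ?_)
  simp

end TwistedCoefficients

section TwistedRicci

variable {EB : Type*} [NormedAddCommGroup EB] [NormedSpace ℝ EB] [FiniteDimensional ℝ EB]
  {ι : Type*} [Fintype ι] {EF : ι → Type*} [∀ i, NormedAddCommGroup (EF i)]
  [∀ i, NormedSpace ℝ (EF i)] [∀ i, FiniteDimensional ℝ (EF i)] [DecidableEq ι]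
  {β : ∀ i, EB × EF i → ℝ} {gB : EB → EB →L[ℝ] EB →L[ℝ] ℝ}
  {gF : ∀ i, EF i → EF i →L[ℝ] EF i →L[ℝ] ℝ} {θ : EB → EB →L[ℝ] ℝ}
  {κB : EB → EB → EB → EB → ℝ} {κF : ∀ i, EF i → EF i → EF i → EF i → ℝ}
  {c : ι → (EB × ∀ i, EF i) → EB → ℝ}

namespace IsTwistedCoeff

variable {S : (EB × ∀ i, EF i) → (EB × ∀ i, EF i) →L[ℝ] (EB × ∀ i, EF i) →L[ℝ] (EB × ∀ i, EF i)}
  {y₀ : EB × ∀ i, EF i}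

lemma hasFDerivAt_apply (h : IsTwistedCoeff S y₀ β gB gF θ κB κF c) (w v : EB × ∀ i, EF i) :
    HasFDerivAt (fun y ↦ S y w v) (((fderiv ℝ S y₀).flip w).flip v) y₀ := by
  have h1 := (h.differentiableAt.hasFDerivAt.clm_apply (hasFDerivAt_const w y₀)).clm_apply
    (hasFDerivAt_const v y₀)
  refine h1.congr_fderiv (ContinuousLinearMap.ext fun u ↦ ?_)
  simp

lemma fderiv_apply (h : IsTwistedCoeff S y₀ β gB gF θ κB κF c) {w v : EB × ∀ i, EF i}
    {f : (EB × ∀ i, EF i) → EB × ∀ i, EF i} {f' : (EB × ∀ i, EF i) →L[ℝ] EB × ∀ i, EF i}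
    (hf : ∀ᶠ y in 𝓝 y₀, S y w v = f y) (hf' : HasFDerivAt f f' y₀) (u : EB × ∀ i, EF i) :
    fderiv ℝ S y₀ u w v = f' u := by
  have h1 := (h.hasFDerivAt_apply w v).congr_of_eventuallyEq
    (EventuallyEq.symm hf)
  exact congrArg (fun L ↦ L u) (h1.unique hf')

lemma hasDerivAt_line (h : IsTwistedCoeff S y₀ β gB gF θ κB κF c) (u w v : EB × ∀ i, EF i) :
    HasDerivAt (fun t : ℝ ↦ S (y₀ + t • u) w v) (fderiv ℝ S y₀ u w v) 0 :=
  (h.hasFDerivAt_apply w v).hasLineDerivAt u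

lemma eventually_line (h : IsTwistedCoeff S y₀ β gB gF θ κB κF c) (u : EB × ∀ i, EF i) :
    ∀ᶠ t : ℝ in 𝓝 0, IsTwistedCoeffAt (S (y₀ + t • u)) (y₀ + t • u) β gB gF θ κB κF c := by
  have hc : Tendsto (fun t : ℝ ↦ y₀ + t • u) (𝓝 0) (𝓝 y₀) := by
    have : Continuous (fun t : ℝ ↦ y₀ + t • u) := by fun_prop
    simpa using this.tendsto 0
  exact hc.eventually h.eventually

lemma hasFDerivAt_twist (h : IsTwistedCoeff S y₀ β gB gF θ κB κF c) (i : ι) (u : EB × EF i) :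
    HasFDerivAt (fun y ↦ fderiv ℝ (β i) (pairProj EB EF i y) u)
      (((fderiv ℝ (fderiv ℝ (β i)) (pairProj EB EF i y₀)).flip u).comp (pairProj EB EF i)) y₀ :=
  hasFDerivAt_fderiv_pairProj (h.contDiffAt i) u

lemma snd_fderiv_comm (h : IsTwistedCoeff S y₀ β gB gF θ κB κF c) (i : ι) (u v : EB × EF i) :
    fderiv ℝ (fderiv ℝ (β i)) (pairProj EB EF i y₀) u v =
      fderiv ℝ (fderiv ℝ (β i)) (pairProj EB EF i y₀) v u :=
  (h.contDiffAt i).isSymmSndFDerivAt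
    (by
      rw [minSmoothness_of_isRCLikeNormedField]
      exact WithTop.coe_le_coe.2 (le_top : (2 : ℕ∞) ≤ ⊤)) u v

/-- The derivative of the fibre part of the coefficients in a base direction. -/
lemma lowered_fderiv_fiberVec (h : IsTwistedCoeff S y₀ β gB gF θ κB κF c) (i : ι) (X : EB)
    (v w z : EF i) :
    gF i (y₀.2 i) ((fderiv ℝ S y₀ (baseVec EF X) (fiberVec EB i w) (fiberVec EB i v)).2 i) z =
      fderiv ℝ (fderiv ℝ (β i)) (pairProj EB EF i y₀) (X, 0) (0, w) * gF i (y₀.2 i) v z +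
      fderiv ℝ (fderiv ℝ (β i)) (pairProj EB EF i y₀) (X, 0) (0, v) * gF i (y₀.2 i) w z -
      fderiv ℝ (fderiv ℝ (β i)) (pairProj EB EF i y₀) (X, 0) (0, z) * gF i (y₀.2 i) w v := by
  let L : (EB × ∀ i, EF i) →L[ℝ] ℝ := ((gF i (y₀.2 i)).flip z).comp
    ((ContinuousLinearMap.proj (R := ℝ) (φ := EF) i).comp (ContinuousLinearMap.snd ℝ EB _))
  have h1 : HasDerivAt
      (fun t : ℝ ↦ L (S (y₀ + t • baseVec EF X) (fiberVec EB i w) (fiberVec EB i v)))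
      (L (fderiv ℝ S y₀ (baseVec EF X) (fiberVec EB i w) (fiberVec EB i v))) 0 :=
    L.hasFDerivAt.comp_hasDerivAt (0 : ℝ)
      (h.hasDerivAt_line (baseVec EF X) (fiberVec EB i w) (fiberVec EB i v))
  have hβ (a : EF i) : HasDerivAt
      (fun t : ℝ ↦ fderiv ℝ (β i) (pairProj EB EF i (y₀ + t • baseVec EF X)) (0, a))
      (fderiv ℝ (fderiv ℝ (β i)) (pairProj EB EF i y₀) (X, 0) (0, a)) 0 :=
    (h.hasFDerivAt_twist i (0, a)).hasLineDerivAt (baseVec EF X)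
  have h2 := ((((hβ w).mul_const (gF i (y₀.2 i) v z)).add
    ((hβ v).mul_const (gF i (y₀.2 i) w z))).sub ((hβ z).mul_const (gF i (y₀.2 i) w v))).add_const
    (κF i (y₀.2 i) w v z)
  refine (h1.congr_of_eventuallyEq ?_).unique h2
  filter_upwards [h.eventually_line (baseVec EF X)] with t ht
  have hy : (y₀ + t • baseVec EF X).2 i = y₀.2 i := by simp
  have h3 := ht.fiber i (fiberVec EB i w) (fiberVec EB i v) z
  rw [hy] at h3
  simp only [fiberVec_snd_same, pairProj_fiberVec_same, fiberVec_fst, map_zero, zero_mul,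
    add_zero] at h3
  exact h3.symm

/-- The base part of the coefficients on base vectors does not depend on the fibre. -/
lemma fderiv_baseVec_baseVec (h : IsTwistedCoeff S y₀ β gB gF θ κB κF c) (i : ι) (v : EF i)
    (X Y : EB) :
    (fderiv ℝ S y₀ (fiberVec EB i v) (baseVec EF Y) (baseVec EF X)).1 = 0 := by
  have h0 := h.eventually.self_of_nhds
  refine h0.nondegenerate_base _ fun z ↦ ?_
  let L : (EB × ∀ i, EF i) →L[ℝ] ℝ := ((gB y₀.1).flip z).comp (ContinuousLinearMap.fst ℝ EB _)
  have h1 : HasDerivAt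
      (fun t : ℝ ↦ L (S (y₀ + t • fiberVec EB i v) (baseVec EF Y) (baseVec EF X)))
      (L (fderiv ℝ S y₀ (fiberVec EB i v) (baseVec EF Y) (baseVec EF X))) 0 :=
    L.hasFDerivAt.comp_hasDerivAt (0 : ℝ)
      (h.hasDerivAt_line (fiberVec EB i v) (baseVec EF Y) (baseVec EF X))
  refine (h1.congr_of_eventuallyEq ?_).unique (hasDerivAt_const (0 : ℝ) (κB y₀.1 Y X z))
  filter_upwards [h.eventually_line (fiberVec EB i v)] with t ht
  have hy : (y₀ + t • fiberVec EB i v).1 = y₀.1 := by simp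
  have h3 := ht.base (baseVec EF Y) (baseVec EF X) z
  rw [hy] at h3
  simp only [baseVec_fst, baseVec_snd, map_zero, mul_zero, Finset.sum_const_zero, sub_zero] at h3
  exact h3.symm

lemma fderiv_fiberVec_of_ne (h : IsTwistedCoeff S y₀ β gB gF θ κB κF c) {i j : ι} (hij : j ≠ i)
    (u : EB × ∀ i, EF i) (w : EF j) (v : EF i) :
    (fderiv ℝ S y₀ u (fiberVec EB j w) (fiberVec EB i v)).2 j = 0 := by
  let L : (EB × ∀ i, EF i) →L[ℝ] EF j :=
    (ContinuousLinearMap.proj (R := ℝ) (φ := EF) j).comp (ContinuousLinearMap.snd ℝ EB _)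
  have h1 : HasDerivAt
      (fun t : ℝ ↦ L (S (y₀ + t • u) (fiberVec EB j w) (fiberVec EB i v)))
      (L (fderiv ℝ S y₀ u (fiberVec EB j w) (fiberVec EB i v))) 0 :=
    L.hasFDerivAt.comp_hasDerivAt (0 : ℝ)
      (h.hasDerivAt_line u (fiberVec EB j w) (fiberVec EB i v))
  refine (h1.congr_of_eventuallyEq ?_).unique (hasDerivAt_const (0 : ℝ) (0 : EF j))
  filter_upwards [h.eventually_line u] with t ht
  exact (ht.fiberVec_apply_snd_of_ne hij w v).symm

lemma fderiv_baseVec_fiberVec (h : IsTwistedCoeff S y₀ β gB gF θ κB κF c) (i : ι)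
    (u : EB × ∀ i, EF i) (X : EB) (v : EF i) :
    fderiv ℝ S y₀ u (baseVec EF X) (fiberVec EB i v) =
      fderiv ℝ (fderiv ℝ (β i)) (pairProj EB EF i y₀) (pairProj EB EF i u) (X, 0) •
        fiberVec EB i v := by
  rw [h.fderiv_apply (h.eventually.mono fun y hy ↦ hy.baseVec_apply_fiberVec X i v)
    ((h.hasFDerivAt_twist i (X, 0)).smul_const (fiberVec EB i v)) u]
  simp

lemma fderiv_fiberVec_baseVec (h : IsTwistedCoeff S y₀ β gB gF θ κB κF c) (i : ι)
    (u : EB × ∀ i, EF i) (X : EB) (v : EF i) :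
    fderiv ℝ S y₀ u (fiberVec EB i v) (baseVec EF X) =
      (fderiv ℝ (fderiv ℝ (β i)) (pairProj EB EF i y₀) (pairProj EB EF i u) (X, 0) +
        fderiv ℝ θ y₀.1 u.1 X) • fiberVec EB i v := by
  have hθ : HasFDerivAt (fun y : EB × ∀ i, EF i ↦ θ y.1 X)
      (((fderiv ℝ θ y₀.1).flip X).comp (ContinuousLinearMap.fst ℝ EB _)) y₀ := by
    have h1 := (h.differentiableAt_form.hasFDerivAt.comp y₀
      (ContinuousLinearMap.fst ℝ EB (∀ i, EF i)).hasFDerivAt).clm_apply (hasFDerivAt_const X y₀)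
    refine h1.congr_fderiv (ContinuousLinearMap.ext fun w ↦ ?_)
    simp
  rw [h.fderiv_apply (h.eventually.mono fun y hy ↦ hy.fiberVec_apply_baseVec X i v)
    (((h.hasFDerivAt_twist i (X, 0)).add hθ).smul_const (fiberVec EB i v)) u]
  simp

/-- The mixed Ricci curvature `Ric(X, V)`. -/
theorem trace_curvatureMap_baseVec_fiberVec (h : IsTwistedCoeff S y₀ β gB gF θ κB κF c) (i : ι)
    (X : EB) (v : EF i) :
    LinearMap.trace ℝ _ (curvatureMap S y₀ (baseVec EF X) (fiberVec EB i v)).toLinearMap =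
      (Module.finrank ℝ (EF i) - 1) *
        fderiv ℝ (fderiv ℝ (β i)) (pairProj EB EF i y₀) (X, 0) (0, v) := by
  have h0 := h.eventually.self_of_nhds
  rw [trace_prod_pi, Finset.sum_eq_single i]
  · rw [show LinearMap.fst ℝ EB (∀ i, EF i) ∘ₗ
      (curvatureMap S y₀ (baseVec EF X) (fiberVec EB i v)).toLinearMap ∘ₗ
      LinearMap.inl ℝ EB _ = 0 from ?_, map_zero, zero_add]
    · refine trace_of_lowered ((gF i (y₀.2 i)).toLinearMap₁₂) (h0.symm_fiber i)
        (h0.nondegenerate_fiber i) _ ((fderiv ℝ (fderiv ℝ (β i)) (pairProj EB EF i y₀)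
          (X, 0)).toLinearMap ∘ₗ LinearMap.inr ℝ EB (EF i)) v fun w z ↦ ?_
      change gF i (y₀.2 i) ((curvatureMap S y₀ (baseVec EF X) (fiberVec EB i v)
        (fiberVec EB i w)).2 i) z = _
      rw [curvatureMap_apply, h.fderiv_baseVec_fiberVec, h0.baseVec_apply_fiberVec, map_smul]
      simp only [Prod.snd_sub, Prod.snd_add, Pi.sub_apply, Pi.add_apply, Prod.smul_snd,
        Pi.smul_apply, h0.baseVec_apply_snd, fiberVec_snd_same]
      rw [add_sub_right_comm, add_sub_cancel_right, map_sub, sub_apply, h.lowered_fderiv_fiberVec,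
        pairProj_fiberVec_same, h.snd_fderiv_comm i (0, w)]
      simp
      ring
    · refine LinearMap.ext fun Y ↦ ?_
      change (curvatureMap S y₀ (baseVec EF X) (fiberVec EB i v) (baseVec EF Y)).1 = 0
      rw [curvatureMap_apply, h.fderiv_baseVec_fiberVec, h.fderiv_baseVec_fiberVec,
        h0.baseVec_apply_fiberVec, h0.baseVec_apply_fiberVec, map_smul, map_smul,
        h0.baseVec_apply_fiberVec, h0.baseVec_apply_fiberVec]
      simp
  · intro j _ hj
    refine (congrArg (LinearMap.trace ℝ (EF j)) (a₂ := 0) (LinearMap.ext fun w ↦ ?_)).trans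
      (map_zero _)
    change (curvatureMap S y₀ (baseVec EF X) (fiberVec EB i v) (fiberVec EB j w)).2 j = 0
    rw [curvatureMap_apply, h.fderiv_baseVec_fiberVec, h0.baseVec_apply_fiberVec, map_smul]
    simp only [Prod.snd_sub, Prod.snd_add, Pi.sub_apply, Pi.add_apply, Prod.smul_snd,
        Pi.smul_apply, h0.baseVec_apply_snd, h.fderiv_fiberVec_of_ne hj,
        h0.fiberVec_apply_snd_of_ne hj, fiberVec_snd_ne hj, smul_zero, add_zero, sub_zero]
  · simp

/-- The mixed Ricci curvature `Ric(V, X)`. -/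
theorem trace_curvatureMap_fiberVec_baseVec (h : IsTwistedCoeff S y₀ β gB gF θ κB κF c) (i : ι)
    (X : EB) (v : EF i) :
    LinearMap.trace ℝ _ (curvatureMap S y₀ (fiberVec EB i v) (baseVec EF X)).toLinearMap =
      (Module.finrank ℝ (EF i) - 1) *
        fderiv ℝ (fderiv ℝ (β i)) (pairProj EB EF i y₀) (X, 0) (0, v) := by
  have h0 := h.eventually.self_of_nhds
  rw [trace_prod_pi, Finset.sum_eq_single i]
  · rw [show LinearMap.fst ℝ EB (∀ i, EF i) ∘ₗ
      (curvatureMap S y₀ (fiberVec EB i v) (baseVec EF X)).toLinearMap ∘ₗ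
      LinearMap.inl ℝ EB _ = 0 from ?_, map_zero, zero_add]
    · rw [trace_smul_id_sub_smulRight _
        (fderiv ℝ (fderiv ℝ (β i)) (pairProj EB EF i y₀) (X, 0) (0, v))
        ((fderiv ℝ (fderiv ℝ (β i)) (pairProj EB EF i y₀)
          (X, 0)).toLinearMap ∘ₗ LinearMap.inr ℝ EB (EF i)) v fun w ↦ ?_]
      · simp
        ring
      · change (curvatureMap S y₀ (fiberVec EB i v) (baseVec EF X) (fiberVec EB i w)).2 i = _
        rw [curvatureMap_apply, h.fderiv_fiberVec_baseVec, h.fderiv_fiberVec_baseVec,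
          h0.fiberVec_apply_baseVec, h0.fiberVec_apply_baseVec, map_smul, map_smul]
        simp only [Prod.snd_sub, Prod.snd_add, Pi.sub_apply, Pi.add_apply, Prod.smul_snd,
          Pi.smul_apply, fiberVec_snd_same, fiberVec_fst, map_zero, pairProj_fiberVec_same]
        rw [h0.fiberVec_apply_snd_comm i v w, h.snd_fderiv_comm i (0, w),
          h.snd_fderiv_comm i (0, v)]
        simp
        abel
    · refine LinearMap.ext fun Y ↦ ?_
      change (curvatureMap S y₀ (fiberVec EB i v) (baseVec EF X) (baseVec EF Y)).1 = 0
      rw [curvatureMap_apply, h.fderiv_fiberVec_baseVec, h0.fiberVec_apply_baseVec, map_smul,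
        h0.baseVec_apply_fiberVec, h0.baseVec_apply_baseVec, h0.fiberVec_apply_baseVec]
      simp [h.fderiv_baseVec_baseVec]
  · intro j _ hj
    refine (congrArg (LinearMap.trace ℝ (EF j)) (a₂ := 0) (LinearMap.ext fun w ↦ ?_)).trans
      (map_zero _)
    change (curvatureMap S y₀ (fiberVec EB i v) (baseVec EF X) (fiberVec EB j w)).2 j = 0
    rw [curvatureMap_apply, h.fderiv_fiberVec_baseVec, h.fderiv_fiberVec_baseVec,
      h0.fiberVec_apply_baseVec, h0.fiberVec_apply_baseVec, map_smul, map_smul]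
    simp only [Prod.snd_sub, Prod.snd_add, Pi.sub_apply, Pi.add_apply, Prod.smul_snd,
      Pi.smul_apply, h0.fiberVec_apply_snd_of_ne hj, h0.fiberVec_apply_snd_of_ne' hj,
      fiberVec_snd_ne hj, pairProj_fiberVec_ne hj, smul_zero, add_zero, sub_zero, fiberVec_fst,
      map_zero, zero_apply, zero_smul]
    rfl
  · simp

end IsTwistedCoeff

end TwistedRicci

section TwistedMetric

variable {EB : Type*} [NormedAddCommGroup EB] [NormedSpace ℝ EB] [FiniteDimensional ℝ EB]
  {ι : Type*} [Fintype ι] {EF : ι → Type*} [∀ i, NormedAddCommGroup (EF i)]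
  [∀ i, NormedSpace ℝ (EF i)] [∀ i, FiniteDimensional ℝ (EF i)]

/-- `G` is, on the open set `U`, the multiply twisted product metric of `gB` and `gF i` with
twisting functions `exp (β i)`. -/
structure IsTwistedMetricOn (U : Set (EB × ∀ i, EF i))
    (G : (EB × ∀ i, EF i) → (EB × ∀ i, EF i) →L[ℝ] (EB × ∀ i, EF i) →L[ℝ] ℝ)
    (β : ∀ i, EB × EF i → ℝ) (gB : EB → EB →L[ℝ] EB →L[ℝ] ℝ)
    (gF : ∀ i, EF i → EF i →L[ℝ] EF i →L[ℝ] ℝ) : Prop where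
  isOpen : IsOpen U
  contDiffOn : ContDiffOn ℝ ∞ G U
  isInvertible y (hy : y ∈ U) : (G y).IsInvertible
  contDiffAt_twist y (hy : y ∈ U) i : ContDiffAt ℝ ∞ (β i) (pairProj EB EF i y)
  contDiffAt_base y (hy : y ∈ U) : ContDiffAt ℝ ∞ gB y.1
  contDiffAt_fiber y (hy : y ∈ U) i : ContDiffAt ℝ ∞ (gF i) (y.2 i)
  nondegenerate_base y (hy : y ∈ U) (u : EB) : (∀ v, gB y.1 u v = 0) → u = 0
  nondegenerate_fiber y (hy : y ∈ U) i (u : EF i) : (∀ v, gF i (y.2 i) u v = 0) → u = 0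
  symm_fiber i (z u v : EF i) : gF i z u v = gF i z v u
  apply_eq y (hy : y ∈ U) u v : G y u v = gB y.1 u.1 v.1 +
    ∑ i, Real.exp (β i (pairProj EB EF i y)) ^ 2 * gF i (y.2 i) (u.2 i) (v.2 i)

variable {U : Set (EB × ∀ i, EF i)}
  {G : (EB × ∀ i, EF i) → (EB × ∀ i, EF i) →L[ℝ] (EB × ∀ i, EF i) →L[ℝ] ℝ}
  {β : ∀ i, EB × EF i → ℝ} {gB : EB → EB →L[ℝ] EB →L[ℝ] ℝ}
  {gF : ∀ i, EF i → EF i →L[ℝ] EF i →L[ℝ] ℝ} {y : EB × ∀ i, EF i}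

/-- The lowered Christoffel symbols of a metric on a vector space. -/
def loweredChristoffel {V : Type*} [NormedAddCommGroup V] [NormedSpace ℝ V]
    (g : V → V →L[ℝ] V →L[ℝ] ℝ) (z u v w : V) : ℝ :=
  1 / 2 * (fderiv ℝ g z u v w + fderiv ℝ g z v u w - fderiv ℝ g z w u v)

lemma fderiv_bilin_apply {V W : Type*} [NormedAddCommGroup V] [NormedSpace ℝ V]
    [NormedAddCommGroup W] [NormedSpace ℝ W] {g : V → W →L[ℝ] W →L[ℝ] ℝ} {z : V}
    (hg : DifferentiableAt ℝ g z) (v w : W) :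
    HasFDerivAt (fun z ↦ g z v w) (((fderiv ℝ g z).flip v).flip w) z := by
  have h1 := (hg.hasFDerivAt.clm_apply (hasFDerivAt_const v z)).clm_apply (hasFDerivAt_const w z)
  refine h1.congr_fderiv (ContinuousLinearMap.ext fun u ↦ ?_)
  simp

namespace IsTwistedMetricOn

lemma fderiv_apply (h : IsTwistedMetricOn U G β gB gF) (hy : y ∈ U) (u v w : EB × ∀ i, EF i) :
    fderiv ℝ G y u v w = fderiv ℝ gB y.1 u.1 v.1 w.1 +
      ∑ i, Real.exp (β i (pairProj EB EF i y)) ^ 2 *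
        (2 * fderiv ℝ (β i) (pairProj EB EF i y) (pairProj EB EF i u) *
            gF i (y.2 i) (v.2 i) (w.2 i) +
          fderiv ℝ (gF i) (y.2 i) (u.2 i) (v.2 i) (w.2 i)) := by
  have hG : DifferentiableAt ℝ G y :=
    (h.contDiffOn.contDiffAt (h.isOpen.mem_nhds hy)).differentiableAt (by simp)
  have h1 := (fderiv_bilin_apply hG v w)
  have hB : HasFDerivAt (fun y : EB × ∀ i, EF i ↦ gB y.1 v.1 w.1) _ y :=
    (fderiv_bilin_apply ((h.contDiffAt_base y hy).differentiableAt (by simp)) v.1 w.1).comp y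
      (ContinuousLinearMap.fst ℝ EB (∀ i, EF i)).hasFDerivAt
  have hF (i : ι) : HasFDerivAt (fun y : EB × ∀ i, EF i ↦ gF i (y.2 i) (v.2 i) (w.2 i)) _ y :=
    HasFDerivAt.comp (g := fun z ↦ gF i z (v.2 i) (w.2 i)) y
      (fderiv_bilin_apply ((h.contDiffAt_fiber y hy i).differentiableAt (by simp)) (v.2 i) (w.2 i))
      ((ContinuousLinearMap.proj (R := ℝ) (φ := EF) i).comp
        (ContinuousLinearMap.snd ℝ EB _)).hasFDerivAt
  have hβ (i : ι) : HasFDerivAt (fun y : EB × ∀ i, EF i ↦ Real.exp (β i (pairProj EB EF i y)) ^ 2)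
      _ y :=
    ((((h.contDiffAt_twist y hy i).differentiableAt (by simp)).hasFDerivAt.comp y
      (pairProj EB EF i).hasFDerivAt).exp).pow 2
  have h2 := hB.add (HasFDerivAt.fun_sum (u := Finset.univ) fun i _ ↦ (hβ i).mul (hF i))
  have h3 := (h1.congr_of_eventuallyEq (by
    filter_upwards [h.isOpen.mem_nhds hy] with y' hy'
    exact (h.apply_eq y' hy' v w).symm)).unique h2
  have h4 := congrArg (fun L ↦ L u) h3
  refine h4.trans ?_
  simp only [add_apply, sum_apply, smul_apply, ContinuousLinearMap.comp_apply,
    ContinuousLinearMap.flip_apply, smul_eq_mul]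
  congr 1
  refine Finset.sum_congr rfl fun i _ ↦ ?_
  simp
  ring

variable [DecidableEq ι]

lemma apply_fiberVec (h : IsTwistedMetricOn U G β gB gF) (hy : y ∈ U) (i : ι)
    (u : EB × ∀ i, EF i) (w : EF i) : G y u (fiberVec EB i w) =
      Real.exp (β i (pairProj EB EF i y)) ^ 2 * gF i (y.2 i) (u.2 i) w := by
  rw [h.apply_eq y hy, Finset.sum_eq_single i]
  · simp
  · intro j _ hj
    simp [fiberVec_snd_ne hj]
  · simp

lemma apply_baseVec (h : IsTwistedMetricOn U G β gB gF) (hy : y ∈ U)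
    (u : EB × ∀ i, EF i) (w : EB) : G y u (baseVec EF w) = gB y.1 u.1 w := by
  simp [h.apply_eq y hy]

lemma isTwistedCoeffAt (h : IsTwistedMetricOn U G β gB gF) (hy : y ∈ U) (QB : EB → EB) :
    IsTwistedCoeffAt (connectionCoeff G (fun y ↦ baseVec EF (QB y.1)) y) y β gB gF
      (fun z ↦ (gB z).flip (QB z))
      (fun z u v w ↦ loweredChristoffel gB z u v w + gB z v (QB z) * gB z u w -
        gB z u v * gB z (QB z) w)
      (fun i ↦ loweredChristoffel (gF i))
      (fun i y w ↦ Real.exp (β i (pairProj EB EF i y)) ^ 2 *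
        (fderiv ℝ (β i) (pairProj EB EF i y) (w, 0) + gB y.1 (QB y.1) w)) where
  nondegenerate_base := h.nondegenerate_base y hy
  nondegenerate_fiber := h.nondegenerate_fiber y hy
  symm_fiber i u v := h.symm_fiber i _ u v
  fiberCoeff_zero i v w := by
    simp [loweredChristoffel]
  fiberCoeff_symm i u v w := by
    have hs : fderiv ℝ (gF i) (y.2 i) w u v = fderiv ℝ (gF i) (y.2 i) w v u := by
      have hd := (h.contDiffAt_fiber y hy i).differentiableAt (by simp)
      have h1 := fderiv_bilin_apply hd u v
      have h2 := fderiv_bilin_apply hd v u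
      have e : (fun z ↦ gF i z u v) = fun z ↦ gF i z v u := funext fun z ↦ h.symm_fiber i z u v
      rw [e] at h1
      exact congrArg (fun L ↦ L w) (h1.unique h2)
    rw [loweredChristoffel, loweredChristoffel, hs]
    ring
  baseCoeff_zero_left v w := by simp [loweredChristoffel]
  baseCoeff_zero_right v w := by simp [loweredChristoffel]
  fiber i u v w := by
    have hE : Real.exp (β i (pairProj EB EF i y)) ^ 2 ≠ 0 := by positivity
    have h1 := congrArg (fun L ↦ L (fiberVec EB i w))
      (apply_connectionCoeff (Q := fun y ↦ baseVec EF (QB y.1)) u v (h.isInvertible y hy))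
    simp only [loweredCoeff_apply, h.apply_fiberVec hy, h.apply_baseVec hy] at h1
    have hs (a b : EB × ∀ i, EF i) : fderiv ℝ G y a b (fiberVec EB i w) =
        Real.exp (β i (pairProj EB EF i y)) ^ 2 *
        (2 * fderiv ℝ (β i) (pairProj EB EF i y) (pairProj EB EF i a) * gF i (y.2 i) (b.2 i) w +
          fderiv ℝ (gF i) (y.2 i) (a.2 i) (b.2 i) w) := by
      rw [h.fderiv_apply hy, Finset.sum_eq_single i]
      · simp
      · intro j _ hj
        simp [fiberVec_snd_ne hj]
      · simp
    have hs' : fderiv ℝ G y (fiberVec EB i w) u v =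
        Real.exp (β i (pairProj EB EF i y)) ^ 2 *
        (2 * fderiv ℝ (β i) (pairProj EB EF i y) (0, w) * gF i (y.2 i) (u.2 i) (v.2 i) +
          fderiv ℝ (gF i) (y.2 i) w (u.2 i) (v.2 i)) := by
      rw [h.fderiv_apply hy, Finset.sum_eq_single i]
      · simp
      · intro j _ hj
        simp [fiberVec_snd_ne hj, pairProj_fiberVec_ne hj]
      · simp
    rw [hs, hs, hs', baseVec_snd, map_zero, zero_apply] at h1
    apply mul_left_cancel₀ hE
    rw [h1, loweredChristoffel, ContinuousLinearMap.flip_apply]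
    ring
  base u v w := by
    have h1 := congrArg (fun L ↦ L (baseVec EF w))
      (apply_connectionCoeff (Q := fun y ↦ baseVec EF (QB y.1)) u v (h.isInvertible y hy))
    simp only [loweredCoeff_apply, h.apply_baseVec hy] at h1
    rw [h1, h.fderiv_apply hy, h.fderiv_apply hy, h.fderiv_apply hy, h.apply_eq y hy,
      loweredChristoffel]
    simp only [baseVec_fst, baseVec_snd, map_zero, pairProj_baseVec, mul_zero, add_zero,
      Finset.sum_const_zero, zero_apply]
    simp only [mul_add, add_mul, Finset.sum_add_distrib]
    have e1 : ∑ i, Real.exp (β i (pairProj EB EF i y)) ^ 2 *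
        (2 * fderiv ℝ (β i) (pairProj EB EF i y) (w, 0) * gF i (y.2 i) (u.2 i) (v.2 i)) =
        2 * ∑ i, Real.exp (β i (pairProj EB EF i y)) ^ 2 *
          fderiv ℝ (β i) (pairProj EB EF i y) (w, 0) * gF i (y.2 i) (u.2 i) (v.2 i) := by
      rw [Finset.mul_sum]
      exact Finset.sum_congr rfl fun i _ ↦ by ring
    have e2 : ∑ i, Real.exp (β i (pairProj EB EF i y)) ^ 2 * gB y.1 (QB y.1) w *
        gF i (y.2 i) (u.2 i) (v.2 i) =
        (∑ i, Real.exp (β i (pairProj EB EF i y)) ^ 2 * gF i (y.2 i) (u.2 i) (v.2 i)) *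
          gB y.1 (QB y.1) w := by
      rw [Finset.sum_mul]
      exact Finset.sum_congr rfl fun i _ ↦ by ring
    rw [e1, e2]
    ring

lemma isTwistedCoeff (h : IsTwistedMetricOn U G β gB gF) (hy : y ∈ U) {QB : EB → EB}
    (hQ : ∀ y ∈ U, ContDiffAt ℝ ∞ QB y.1) :
    IsTwistedCoeff (connectionCoeff G (fun y ↦ baseVec EF (QB y.1))) y β gB gF
      (fun z ↦ (gB z).flip (QB z))
      (fun z u v w ↦ loweredChristoffel gB z u v w + gB z v (QB z) * gB z u w -
        gB z u v * gB z (QB z) w)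
      (fun i ↦ loweredChristoffel (gF i))
      (fun i y w ↦ Real.exp (β i (pairProj EB EF i y)) ^ 2 *
        (fderiv ℝ (β i) (pairProj EB EF i y) (w, 0) + gB y.1 (QB y.1) w)) where
  differentiableAt := by
    refine ((contDiffOn_connectionCoeff h.isOpen h.contDiffOn h.isInvertible ?_).contDiffAt
      (h.isOpen.mem_nhds hy)).differentiableAt (by simp)
    intro y' hy'
    exact (((ContinuousLinearMap.inl ℝ EB (∀ i, EF i)).contDiff.contDiffAt).comp y'
      ((hQ y' hy').comp y' contDiffAt_fst)).contDiffWithinAt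
  contDiffAt := h.contDiffAt_twist y hy
  differentiableAt_form := by
    have h1 : DifferentiableAt ℝ (fun z ↦ (gB z).flip) y.1 :=
      (ContinuousLinearMap.flipₗᵢ ℝ EB EB ℝ).toContinuousLinearEquiv.differentiableAt.comp y.1
        ((h.contDiffAt_base y hy).differentiableAt (by simp))
    exact h1.clm_apply ((hQ y hy).differentiableAt (by simp))
  eventually := by
    filter_upwards [h.isOpen.mem_nhds hy] with y' hy' using h.isTwistedCoeffAt hy' QB

end IsTwistedMetricOn

end TwistedMetric

section ProductChart

instance boundaryless_pi {ι : Type*} [Fintype ι] {E : ι → Type*} [∀ i, NormedAddCommGroup (E i)]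
    [∀ i, NormedSpace ℝ (E i)] {H : ι → Type*} [∀ i, TopologicalSpace (H i)]
    (I : ∀ i, ModelWithCorners ℝ (E i) (H i)) [∀ i, (I i).Boundaryless] :
    (ModelWithCorners.pi I).Boundaryless := by
  refine ⟨Set.eq_univ_of_forall fun y ↦ ?_⟩
  choose z hz using fun i ↦ (I i).range_eq_univ ▸ Set.mem_univ (y i)
  exact ⟨z, funext hz⟩

variable {EB : Type*} [NormedAddCommGroup EB] [NormedSpace ℝ EB] [FiniteDimensional ℝ EB]
  {HB : Type*} [TopologicalSpace HB] {IB : ModelWithCorners ℝ EB HB} [IB.Boundaryless]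
  {B : Type*} [TopologicalSpace B] [ChartedSpace HB B] [IsManifold IB ∞ B]
  {ι : Type*} [Fintype ι]
  {EF : ι → Type*} [∀ i, NormedAddCommGroup (EF i)] [∀ i, NormedSpace ℝ (EF i)]
  [∀ i, FiniteDimensional ℝ (EF i)]
  {HF : ι → Type*} [∀ i, TopologicalSpace (HF i)] {IF : ∀ i, ModelWithCorners ℝ (EF i) (HF i)}
  [∀ i, (IF i).Boundaryless]
  {F : ι → Type*} [∀ i, TopologicalSpace (F i)] [∀ i, ChartedSpace (HF i) (F i)]
  [∀ i, IsManifold (IF i) ∞ (F i)]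

lemma extChartAt_product_fst (x₀ x : B × ∀ i, F i) :
    (extChartAt (productModel IB IF) x₀ x).1 = extChartAt IB x₀.1 x.1 := rfl

lemma fst_mem_extChartAt_target {x₀ : B × ∀ i, F i} {y : EB × ∀ i, EF i}
    (hy : y ∈ (extChartAt (productModel IB IF) x₀).target) :
    y.1 ∈ (extChartAt IB x₀.1).target := by
  rw [extChartAt_prod] at hy
  exact hy.1

lemma snd_mem_extChartAt_target {x₀ : B × ∀ i, F i} {y : EB × ∀ i, EF i}
    (hy : y ∈ (extChartAt (productModel IB IF) x₀).target) (i : ι) :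
    y.2 i ∈ (extChartAt (IF i) (x₀.2 i)).target := by
  rw [extChartAt_prod] at hy
  exact extChartAt_pi_target IF F x₀.2 hy.2 i

lemma chartFrame_symm_eq_mfderiv {E : Type*} [NormedAddCommGroup E] [NormedSpace ℝ E]
    [FiniteDimensional ℝ E] {H : Type*} [TopologicalSpace H] {I : ModelWithCorners ℝ E H}
    [I.Boundaryless] {M : Type*} [TopologicalSpace M] [ChartedSpace H M] [IsManifold I ∞ M]
    {x₀ : M} {y : E} (hy : y ∈ (extChartAt I x₀).target) (u : E) :
    chartFrame (I := I) x₀ ((extChartAt I x₀).symm y) u =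
      mfderiv 𝓘(ℝ, E) I (extChartAt I x₀).symm y u := by
  have h := chartFrame_eq_mfderiv ((extChartAt I x₀).map_target hy) u
  rwa [(extChartAt I x₀).right_inv hy] at h

lemma mdifferentiableAt_symm_of_mem_target {E : Type*} [NormedAddCommGroup E] [NormedSpace ℝ E]
    [FiniteDimensional ℝ E] {H : Type*} [TopologicalSpace H] {I : ModelWithCorners ℝ E H}
    [I.Boundaryless] {M : Type*} [TopologicalSpace M] [ChartedSpace H M] [IsManifold I ∞ M]
    {x₀ : M} {y : E} (hy : y ∈ (extChartAt I x₀).target) :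
    MDifferentiableAt 𝓘(ℝ, E) I (extChartAt I x₀).symm y := by
  have h := mdifferentiableAt_extChartAt_symm' ((extChartAt I x₀).map_target hy)
  rwa [(extChartAt I x₀).right_inv hy] at h

lemma basePart_chartFrame {x₀ : B × ∀ i, F i} {y : EB × ∀ i, EF i}
    (hy : y ∈ (extChartAt (productModel IB IF) x₀).target) (u : EB × ∀ i, EF i) :
    basePart (IB := IB) (IF := IF) ((extChartAt (productModel IB IF) x₀).symm y)
      (chartFrame x₀ _ u) = chartFrame (I := IB) x₀.1 ((extChartAt IB x₀.1).symm y.1) u.1 := by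
  rw [chartFrame_symm_eq_mfderiv hy, chartFrame_symm_eq_mfderiv (fst_mem_extChartAt_target hy)]
  have h1 := (hasMFDerivAt_fst (I := IB) (I' := ModelWithCorners.pi IF)
    ((extChartAt (productModel IB IF) x₀).symm y)).comp y
    (mdifferentiableAt_symm_of_mem_target hy).hasMFDerivAt
  have h2 := (mdifferentiableAt_symm_of_mem_target
    (fst_mem_extChartAt_target hy)).hasMFDerivAt.comp y
    (ContinuousLinearMap.fst ℝ EB (∀ i, EF i)).hasMFDerivAt
  exact congrArg (fun L ↦ L u) (hasMFDerivAt_unique h1 h2)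

lemma fiberPart_chartFrame {x₀ : B × ∀ i, F i} {y : EB × ∀ i, EF i}
    (hy : y ∈ (extChartAt (productModel IB IF) x₀).target) (i : ι) (u : EB × ∀ i, EF i) :
    fiberPart (IB := IB) (IF := IF) i ((extChartAt (productModel IB IF) x₀).symm y)
      (chartFrame x₀ _ u) =
        chartFrame (I := IF i) (x₀.2 i) ((extChartAt (IF i) (x₀.2 i)).symm (y.2 i)) (u.2 i) := by
  rw [chartFrame_symm_eq_mfderiv hy, chartFrame_symm_eq_mfderiv (snd_mem_extChartAt_target hy i)]
  have h1 := ((hasMFDerivAt_eval IF F i ((extChartAt (productModel IB IF) x₀).symm y).2).comp _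
    (hasMFDerivAt_snd (I := IB) (I' := ModelWithCorners.pi IF)
    ((extChartAt (productModel IB IF) x₀).symm y))).comp y
    (mdifferentiableAt_symm_of_mem_target hy).hasMFDerivAt
  have h2 := HasMFDerivAt.comp (I' := 𝓘(ℝ, EF i)) (g := (extChartAt (IF i) (x₀.2 i)).symm) y
    (mdifferentiableAt_symm_of_mem_target (snd_mem_extChartAt_target hy i)).hasMFDerivAt
    ((ContinuousLinearMap.proj (R := ℝ) (φ := EF) i).comp
        (ContinuousLinearMap.snd ℝ EB _)).hasMFDerivAt
  exact congrArg (fun L ↦ L u) (hasMFDerivAt_unique h1 h2)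

end ProductChart

section Constant

variable {E : Type*} [NormedAddCommGroup E] [NormedSpace ℝ E] [FiniteDimensional ℝ E]
  {H : Type*} [TopologicalSpace H] {I : ModelWithCorners ℝ E H} [I.Boundaryless]
  {M : Type*} [TopologicalSpace M] [ChartedSpace H M] [IsManifold I ∞ M]
  {G : Type*} [NormedAddCommGroup G] [NormedSpace ℝ G]

lemma mvfderiv_eq_fderiv_comp_symm {f : M → G} {x : M} (hf : MDiffAt f x) (u : TangentSpace I x) :
    mvfderiv I f x u = fderiv ℝ (f ∘ (extChartAt I x).symm) (extChartAt I x x) u :=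
  (congrArg (fun w : TangentSpace I x ↦ mvfderiv I f x w) (chartFrame_self (E := E) x u).symm).trans
    (mvfderiv_chartFrame (mem_extChartAt_source x) hf u)

lemma mvfderiv_const_apply (c : G) (x : M) (u : TangentSpace I x) :
    mvfderiv I (fun _ : M ↦ c) x u = 0 := by
  rw [mvfderiv_const]
  rfl

lemma fderiv_comp_extChartAt_symm_eq_zero {f : M → G} (hf : MDiff f)
    (h : ∀ x (u : TangentSpace I x), mvfderiv I f x u = 0) {x₀ : M} {y : E}
    (hy : y ∈ (extChartAt I x₀).target) : fderiv ℝ (f ∘ (extChartAt I x₀).symm) y = 0 := by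
  ext u
  have h1 := mvfderiv_chartFrame ((extChartAt I x₀).map_target hy) (hf _) u
  rw [(extChartAt I x₀).right_inv hy, h] at h1
  exact h1.symm

lemma apply_eq_of_mvfderiv_eq_zero [PreconnectedSpace M] {f : M → G} (hf : MDiff f)
    (h : ∀ x (u : TangentSpace I x), mvfderiv I f x u = 0) (x x' : M) : f x = f x' := by
  refine IsLocallyConstant.apply_eq_of_preconnectedSpace
    ((IsLocallyConstant.iff_eventually_eq f).2 fun x₀ ↦ ?_) x x'
  obtain ⟨r, hr, hball⟩ := Metric.isOpen_iff.1 (isOpen_extChartAt_target x₀) _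
    (mem_extChartAt_target (I := I) x₀)
  filter_upwards [eventually_mem_chart_source (I := I) x₀ (mem_extChartAt_source x₀),
    (continuousAt_extChartAt (I := I) x₀).preimage_mem_nhds (Metric.ball_mem_nhds _ hr)]
    with z hz hzr
  have hd : DifferentiableOn ℝ (f ∘ (extChartAt I x₀).symm)
      (Metric.ball (extChartAt I x₀ x₀) r) := fun y hy ↦
    (mdifferentiableAt_iff_differentiableAt.1 ((hf _).comp y
      (mdifferentiableAt_symm_of_mem_target (hball hy)))).differentiableWithinAt
  have h1 := Metric.isOpen_ball.is_const_of_fderiv_eq_zero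
    (convex_ball (extChartAt I x₀ x₀) r).isPreconnected hd
    (fun y hy ↦ fderiv_comp_extChartAt_symm_eq_zero hf h (hball hy)) hzr
    (Metric.mem_ball_self hr)
  simpa only [Function.comp_apply, (extChartAt I x₀).left_inv hz,
    (extChartAt I x₀).left_inv (mem_extChartAt_source x₀)] using h1

end Constant

section MixedDerivative

variable {E₁ : Type*} [NormedAddCommGroup E₁] [NormedSpace ℝ E₁] [FiniteDimensional ℝ E₁]
  {H₁ : Type*} [TopologicalSpace H₁] {I₁ : ModelWithCorners ℝ E₁ H₁} [I₁.Boundaryless]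
  {M₁ : Type*} [TopologicalSpace M₁] [ChartedSpace H₁ M₁] [IsManifold I₁ ∞ M₁]
  {E₂ : Type*} [NormedAddCommGroup E₂] [NormedSpace ℝ E₂] [FiniteDimensional ℝ E₂]
  {H₂ : Type*} [TopologicalSpace H₂] {I₂ : ModelWithCorners ℝ E₂ H₂} [I₂.Boundaryless]
  {M₂ : Type*} [TopologicalSpace M₂] [ChartedSpace H₂ M₂] [IsManifold I₂ ∞ M₂]
  {f : M₁ × M₂ → ℝ}

variable (I₁ I₂) in
/-- The coordinate expression of a function on a product of two manifolds. -/
def pairInChart (f : M₁ × M₂ → ℝ) (p : M₁) (q : M₂) (z : E₁ × E₂) : ℝ :=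
  f ((extChartAt I₁ p).symm z.1, (extChartAt I₂ q).symm z.2)

lemma contDiffAt_pairInChart (hf : ContMDiff (I₁.prod I₂) 𝓘(ℝ) ∞ f) {p : M₁} {q : M₂}
    {z : E₁ × E₂} (h1 : z.1 ∈ (extChartAt I₁ p).target) (h2 : z.2 ∈ (extChartAt I₂ q).target) :
    ContDiffAt ℝ ∞ (pairInChart I₁ I₂ f p q) z := by
  have hz : z ∈ (extChartAt (I₁.prod I₂) (p, q)).target := by
    rw [extChartAt_prod]
    exact ⟨h1, h2⟩
  have h : ContDiffOn ℝ ∞ (f ∘ (extChartAt (I₁.prod I₂) (p, q)).symm)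
      (extChartAt (I₁.prod I₂) (p, q)).target := by
    rw [← contMDiffOn_iff_contDiffOn]
    exact hf.comp_contMDiffOn (contMDiffOn_extChartAt_symm (p, q))
  exact h.contDiffAt ((isOpen_extChartAt_target (p, q)).mem_nhds hz)

lemma mvfderiv_snd_eq (hf : ContMDiff (I₁.prod I₂) 𝓘(ℝ) ∞ f) {p₀ p : M₁} (q : M₂)
    (hp : p ∈ (extChartAt I₁ p₀).source) (v : TangentSpace I₂ q) :
    mvfderiv I₂ (fun q' ↦ f (p, q')) q v =
      fderiv ℝ (pairInChart I₁ I₂ f p₀ q) (extChartAt I₁ p₀ p, extChartAt I₂ q q) (0, v) := by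
  have hd : MDiffAt (fun q' ↦ f (p, q')) q :=
    ((hf.comp (contMDiff_const.prodMk contMDiff_id)).mdifferentiable (by simp)) q
  refine (mvfderiv_eq_fderiv_comp_symm hd v).trans ?_
  have hc : HasFDerivAt (fun z : E₂ ↦ (extChartAt I₁ p₀ p, z))
      (ContinuousLinearMap.inr ℝ E₁ E₂) (extChartAt I₂ q q) :=
    (hasFDerivAt_const _ _).prodMk (hasFDerivAt_id _)
  have h1 := ((contDiffAt_pairInChart hf ((extChartAt I₁ p₀).map_source hp)
    (mem_extChartAt_target (I := I₂) q)).differentiableAt (by simp)).hasFDerivAt.comp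
      (extChartAt I₂ q q) hc
  have e : (fun q' ↦ f (p, q')) ∘ (extChartAt I₂ q).symm =
      pairInChart I₁ I₂ f p₀ q ∘ fun z : E₂ ↦ (extChartAt I₁ p₀ p, z) := by
    ext z
    simp only [Function.comp_apply, pairInChart, (extChartAt I₁ p₀).left_inv hp]
  rw [e, h1.fderiv]
  rfl

lemma hasFDerivAt_fderiv_pairInChart (hf : ContMDiff (I₁.prod I₂) 𝓘(ℝ) ∞ f) (p : M₁) (q : M₂)
    (v : E₂) :
    HasFDerivAt (fun z : E₁ ↦ fderiv ℝ (pairInChart I₁ I₂ f p q) (z, extChartAt I₂ q q) (0, v))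
      (((fderiv ℝ (fderiv ℝ (pairInChart I₁ I₂ f p q))
        (extChartAt I₁ p p, extChartAt I₂ q q)).comp (ContinuousLinearMap.inl ℝ E₁ E₂)).flip
          (0, v)) (extChartAt I₁ p p) := by
  have hc : HasFDerivAt (fun z : E₁ ↦ (z, extChartAt I₂ q q))
      (ContinuousLinearMap.inl ℝ E₁ E₂) (extChartAt I₁ p p) :=
    (hasFDerivAt_id _).prodMk (hasFDerivAt_const _ _)
  have h1 : DifferentiableAt ℝ (fderiv ℝ (pairInChart I₁ I₂ f p q))
      (extChartAt I₁ p p, extChartAt I₂ q q) :=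
    ((contDiffAt_pairInChart hf (mem_extChartAt_target (I := I₁) p)
      (mem_extChartAt_target (I := I₂) q)).fderiv_right (m := 1)
        (WithTop.coe_le_coe.2 (le_top : (2 : ℕ∞) ≤ ⊤))).differentiableAt (by simp)
  have h2 := (h1.hasFDerivAt.comp (extChartAt I₁ p p) hc).clm_apply (hasFDerivAt_const (0, v) _)
  refine h2.congr_fderiv (ContinuousLinearMap.ext fun u ↦ ?_)
  simp

lemma mvfderiv_snd_eventuallyEq (hf : ContMDiff (I₁.prod I₂) 𝓘(ℝ) ∞ f) (p : M₁) (q : M₂)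
    (v : TangentSpace I₂ q) :
    (fun p' ↦ mvfderiv I₂ (fun q' ↦ f (p', q')) q v) =ᶠ[𝓝 p]
      (fun z : E₁ ↦ fderiv ℝ (pairInChart I₁ I₂ f p q) (z, extChartAt I₂ q q) (0, v)) ∘
        extChartAt I₁ p := by
  filter_upwards [eventually_mem_chart_source (I := I₁) p (mem_extChartAt_source p)] with p' hp'
  exact mvfderiv_snd_eq hf q hp' v

lemma mdifferentiable_mvfderiv_snd (hf : ContMDiff (I₁.prod I₂) 𝓘(ℝ) ∞ f) (q : M₂)
    (v : TangentSpace I₂ q) :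
    MDifferentiable I₁ 𝓘(ℝ) fun p ↦ mvfderiv I₂ (fun q' ↦ f (p, q')) q v := by
  intro p
  refine MDifferentiableAt.congr_of_eventuallyEq ?_ (mvfderiv_snd_eventuallyEq hf p q v)
  exact (hasFDerivAt_fderiv_pairInChart hf p q v).differentiableAt.mdifferentiableAt.comp p
    (mdifferentiableAt_extChartAt (mem_chart_source _ p))

lemma mvfderiv_mvfderiv_snd (hf : ContMDiff (I₁.prod I₂) 𝓘(ℝ) ∞ f) (p : M₁) (q : M₂)
    (u : TangentSpace I₁ p) (v : TangentSpace I₂ q) :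
    mvfderiv I₁ (fun p' ↦ mvfderiv I₂ (fun q' ↦ f (p', q')) q v) p u =
      fderiv ℝ (fderiv ℝ (pairInChart I₁ I₂ f p q)) (extChartAt I₁ p p, extChartAt I₂ q q)
        (u, 0) (0, v) := by
  refine (mvfderiv_eq_fderiv_comp_symm (mdifferentiable_mvfderiv_snd hf q v p) u).trans ?_
  have e : (fun p' ↦ mvfderiv I₂ (fun q' ↦ f (p', q')) q v) ∘ (extChartAt I₁ p).symm
      =ᶠ[𝓝 (extChartAt I₁ p p)]
        fun z : E₁ ↦ fderiv ℝ (pairInChart I₁ I₂ f p q) (z, extChartAt I₂ q q) (0, v) := by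
    filter_upwards [(isOpen_extChartAt_target p).mem_nhds (mem_extChartAt_target (I := I₁) p)]
      with z hz
    refine (mvfderiv_snd_eq hf q ((extChartAt I₁ p).map_target hz) v).trans ?_
    rw [(extChartAt I₁ p).right_inv hz]
  rw [e.fderiv_eq, (hasFDerivAt_fderiv_pairInChart hf p q v).fderiv]
  rfl

lemma mvfderiv_mvfderiv_snd_eq_zero_iff [PreconnectedSpace M₁] [PreconnectedSpace M₂]
    (hf : ContMDiff (I₁.prod I₂) 𝓘(ℝ) ∞ f) :
    (∀ p q (u : TangentSpace I₁ p) (v : TangentSpace I₂ q),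
      mvfderiv I₁ (fun p' ↦ mvfderiv I₂ (fun q' ↦ f (p', q')) q v) p u = 0) ↔
    ∀ p p' q q', f (p, q) - f (p', q) = f (p, q') - f (p', q') := by
  have hd (p : M₁) : MDifferentiable I₂ 𝓘(ℝ) fun q ↦ f (p, q) :=
    (hf.comp (contMDiff_const.prodMk contMDiff_id)).mdifferentiable (by simp)
  constructor
  · intro h p p'
    refine apply_eq_of_mvfderiv_eq_zero (I := I₂) (f := fun q ↦ f (p, q) - f (p', q))
      ((hd p).sub (hd p')) fun q v ↦ ?_
    have h1 := apply_eq_of_mvfderiv_eq_zero (mdifferentiable_mvfderiv_snd hf q v)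
      (fun p u ↦ h p q u v) p p'
    have h2 := mvfderiv_sub (hd p q) (hd p' q)
    have h3 := congrArg (fun L ↦ L v) h2
    refine h3.trans ?_
    exact sub_eq_zero.2 h1
  · intro h p q u v
    have e : (fun p' ↦ mvfderiv I₂ (fun q' ↦ f (p', q')) q v) =
        fun _ ↦ mvfderiv I₂ (fun q' ↦ f (p, q')) q v := by
      ext p'
      have e1 : (fun q' ↦ f (p', q')) = (fun q' ↦ f (p, q')) + fun _ ↦ f (p', q) - f (p, q) := by
        ext q'
        simp only [Pi.add_apply]
        linarith [h p p' q q']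
      rw [e1, mvfderiv_add (hd p q) mdifferentiableAt_const]
      exact (congrArg _ (mvfderiv_const_apply _ q v)).trans (add_zero _)
    rw [e]
    exact mvfderiv_const_apply _ p u

end MixedDerivative

section TwistedProduct

variable {EB : Type*} [NormedAddCommGroup EB] [NormedSpace ℝ EB] [FiniteDimensional ℝ EB]
  {HB : Type*} [TopologicalSpace HB] {IB : ModelWithCorners ℝ EB HB} [IB.Boundaryless]
  {B : Type*} [TopologicalSpace B] [ChartedSpace HB B] [IsManifold IB ∞ B]
  {ι : Type*} [Fintype ι]
  {EF : ι → Type*} [∀ i, NormedAddCommGroup (EF i)] [∀ i, NormedSpace ℝ (EF i)]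
  [∀ i, FiniteDimensional ℝ (EF i)]
  {HF : ι → Type*} [∀ i, TopologicalSpace (HF i)] {IF : ∀ i, ModelWithCorners ℝ (EF i) (HF i)}
  [∀ i, (IF i).Boundaryless]
  {F : ι → Type*} [∀ i, TopologicalSpace (F i)] [∀ i, ChartedSpace (HF i) (F i)]
  [∀ i, IsManifold (IF i) ∞ (F i)]

section Coordinates

variable {E : Type*} [NormedAddCommGroup E] [NormedSpace ℝ E] [FiniteDimensional ℝ E]
  {H : Type*} [TopologicalSpace H] {I : ModelWithCorners ℝ E H} [I.Boundaryless]
  {M : Type*} [TopologicalSpace M] [ChartedSpace H M] [IsManifold I ∞ M]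

/-- The coordinate expression of a vector field in the chart at `x₀`. -/
def fieldInChart (x₀ : M) (P : Π x : M, TangentSpace I x) (y : E) : E :=
  chartCoframe x₀ ((extChartAt I x₀).symm y) (P ((extChartAt I x₀).symm y))

lemma chartFrame_fieldInChart {x₀ x : M} (hx : x ∈ (extChartAt I x₀).source)
    (P : Π x : M, TangentSpace I x) :
    chartFrame x₀ x (fieldInChart x₀ P (extChartAt I x₀ x)) = P x := by
  have h : fieldInChart x₀ P (extChartAt I x₀ x) = chartCoframe x₀ x (P x) := by
    unfold fieldInChart
    rw [(extChartAt I x₀).left_inv hx]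
  rw [h, chartFrame_chartCoframe hx]

lemma contDiffAt_fieldInChart {P : Π x : M, TangentSpace I x}
    (hP : ContMDiff I I.tangent ∞ (fun x ↦ (⟨x, P x⟩ : TangentBundle I M))) {x₀ : M} {y : E}
    (hy : y ∈ (extChartAt I x₀).target) : ContDiffAt ℝ ∞ (fieldInChart x₀ P) y := by
  have h : ContDiffOn ℝ ∞ (fieldInChart x₀ P) (extChartAt I x₀).target := by
    rw [← contMDiffOn_iff_contDiffOn]
    intro z hz
    have hx := (extChartAt I x₀).map_target hz
    have h1 := ((trivializationAt E (TangentSpace I) x₀).contMDiffAt_section_iff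
      (mem_baseSet_of_mem_source hx)).1 (hP ((extChartAt I x₀).symm z))
    refine (h1.comp_contMDiffWithinAt z
      (contMDiffOn_extChartAt_symm x₀ z hz)).congr_of_mem (fun w hw ↦ ?_) hz
    exact Trivialization.continuousLinearMapAt_apply_of_mem (R := ℝ) _
      (mem_baseSet_of_mem_source ((extChartAt I x₀).map_target hw)) _
  exact h.contDiffAt ((isOpen_extChartAt_target x₀).mem_nhds hy)

end Coordinates

variable {gB : PseudoRiemannianMetric IB B} {gF : ∀ i, PseudoRiemannianMetric (IF i) (F i)}
  {b : ∀ i, B × F i → ℝ} {hb : ∀ i, ContMDiff (IB.prod (IF i)) 𝓘(ℝ) ∞ (b i)}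
  {hpos : ∀ i p, 0 < b i p}

lemma multiplyTwistedMetric_val (x : B × ∀ i, F i) (u v : TangentSpace (productModel IB IF) x) :
    (multiplyTwistedMetric gB gF b hb hpos).val x u v =
      gB.val x.1 (basePart x u) (basePart x v) +
      ∑ i, b i (x.1, x.2 i) ^ 2 * (gF i).val (x.2 i) (fiberPart i x u) (fiberPart i x v) := rfl

lemma contMDiff_log {E : Type*} [NormedAddCommGroup E] [NormedSpace ℝ E]
    {H : Type*} [TopologicalSpace H] {I : ModelWithCorners ℝ E H}
    {M : Type*} [TopologicalSpace M] [ChartedSpace H M] {f : M → ℝ} (hf : ContMDiff I 𝓘(ℝ) ∞ f)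
    (hpos : ∀ x, 0 < f x) : ContMDiff I 𝓘(ℝ) ∞ fun x ↦ Real.log (f x) := fun x ↦
  (Real.contDiffAt_log.2 (hpos x).ne').contMDiffAt.comp x (hf x)

lemma isTwistedMetricOn_inChart (hb : ∀ i, ContMDiff (IB.prod (IF i)) 𝓘(ℝ) ∞ (b i))
    (hpos : ∀ i p, 0 < b i p) (x₀ : B × ∀ i, F i) :
    IsTwistedMetricOn (extChartAt (productModel IB IF) x₀).target
      ((multiplyTwistedMetric gB gF b hb hpos).inChart x₀)
      (fun i ↦ pairInChart IB (IF i) (fun p ↦ Real.log (b i p)) x₀.1 (x₀.2 i))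
      (gB.inChart x₀.1) (fun i ↦ (gF i).inChart (x₀.2 i)) where
  isOpen := isOpen_extChartAt_target x₀
  contDiffOn := PseudoRiemannianMetric.contDiffOn_inChart _ x₀
  isInvertible y hy := PseudoRiemannianMetric.isInvertible_inChart _ hy
  contDiffAt_twist y hy i := contDiffAt_pairInChart (contMDiff_log (hb i) (hpos i))
    (fst_mem_extChartAt_target hy) (snd_mem_extChartAt_target hy i)
  contDiffAt_base y hy := gB.contDiffAt_inChart (fst_mem_extChartAt_target hy)
  contDiffAt_fiber y hy i := (gF i).contDiffAt_inChart (snd_mem_extChartAt_target hy i)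
  nondegenerate_base y hy u h := gB.inChart_nondegenerate (fst_mem_extChartAt_target hy) h
  nondegenerate_fiber y hy i u h :=
    (gF i).inChart_nondegenerate (snd_mem_extChartAt_target hy i) h
  symm_fiber i z u v := (gF i).inChart_symm _ _ _ _
  apply_eq y hy u v := by
    rw [PseudoRiemannianMetric.inChart_apply, multiplyTwistedMetric_val]
    simp only [basePart_chartFrame hy, fiberPart_chartFrame hy]
    refine congrArg _ (Finset.sum_congr rfl fun i _ ↦ ?_)
    have e : Real.exp (pairInChart IB (IF i) (fun p ↦ Real.log (b i p)) x₀.1 (x₀.2 i)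
        (pairProj EB EF i y)) = b i (((extChartAt (productModel IB IF) x₀).symm y).1,
          ((extChartAt (productModel IB IF) x₀).symm y).2 i) :=
      Real.exp_log (hpos i _)
    rw [e]
    rfl

variable [DecidableEq ι]

lemma liftBase_eq_chartField (P : Π p : B, TangentSpace IB p) {x₀ x : B × ∀ i, F i}
    (hx : x ∈ (extChartAt (productModel IB IF) x₀).source) :
    liftBase (IF := IF) P x =
      chartField x₀ (fun y ↦ baseVec EF (fieldInChart x₀.1 P y.1)) x := by
  have hy := (extChartAt (productModel IB IF) x₀).map_source hx
  have hB := basePart_chartFrame hy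
    (baseVec EF (fieldInChart x₀.1 P (extChartAt (productModel IB IF) x₀ x).1))
  have hF i := fiberPart_chartFrame hy i
    (baseVec EF (fieldInChart x₀.1 P (extChartAt (productModel IB IF) x₀ x).1))
  have hx1 : x.1 ∈ (extChartAt IB x₀.1).source := by
    rw [extChartAt_prod] at hx
    exact hx.1
  rw [(extChartAt (productModel IB IF) x₀).left_inv hx] at hB hF
  rw [← sub_eq_zero]
  refine eq_zero_of_parts ?_ fun i ↦ ?_
  · rw [map_sub, sub_eq_zero]
    refine Eq.trans ?_ hB.symm
    rw [baseVec_fst, extChartAt_product_fst, (extChartAt IB x₀.1).left_inv hx1,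
      chartFrame_fieldInChart hx1]
    rfl
  · rw [map_sub, sub_eq_zero]
    refine Eq.trans ?_ (hF i).symm
    rw [baseVec_snd, map_zero]
    rfl

variable {P : Π p : B, TangentSpace IB p}

lemma ricciOf_twisted_eq_trace (hb : ∀ i, ContMDiff (IB.prod (IF i)) 𝓘(ℝ) ∞ (b i))
    (hpos : ∀ i p, 0 < b i p)
    (hP : ContMDiff IB IB.tangent ∞ (fun p ↦ (⟨p, P p⟩ : TangentBundle IB B)))
    (x : B × ∀ i, F i) (u v : TangentSpace (productModel IB IF) x) :
    ricciOf ((multiplyTwistedMetric gB gF b hb hpos).semiSymmetricConnection (liftBase P)) x u v =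
      LinearMap.trace ℝ (EB × ∀ i, EF i) (curvatureMap (connectionCoeff
        ((multiplyTwistedMetric gB gF b hb hpos).inChart x)
          (fun y ↦ baseVec EF (fieldInChart x.1 P y.1)))
        (extChartAt (productModel IB IF) x x) u v).toLinearMap := by
  refine PseudoRiemannianMetric.ricciOf_semiSymmetricConnection _ x (fun y hy ↦ ?_)
    (fun y hy ↦ liftBase_eq_chartField P hy) u v
  have h : ContDiffAt ℝ ∞ (fun y : EB × ∀ i, EF i ↦ fieldInChart x.1 P y.1) y :=
    (contDiffAt_fieldInChart hP (fst_mem_extChartAt_target hy)).comp y contDiffAt_fst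
  exact (h.prodMk contDiffAt_const).contDiffWithinAt

theorem ricciOf_ofBase_ofFiber (hb : ∀ i, ContMDiff (IB.prod (IF i)) 𝓘(ℝ) ∞ (b i))
    (hpos : ∀ i p, 0 < b i p)
    (hP : ContMDiff IB IB.tangent ∞ (fun p ↦ (⟨p, P p⟩ : TangentBundle IB B)))
    (x : B × ∀ i, F i) (u : TangentSpace IB x.1) (i : ι) (v : TangentSpace (IF i) (x.2 i)) :
    ricciOf ((multiplyTwistedMetric gB gF b hb hpos).semiSymmetricConnection (liftBase P)) x
      (ofBase x u) (ofFiber i x v) = (Module.finrank ℝ (EF i) - 1) *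
        mvfderiv IB (fun p ↦ mvfderiv (IF i) (fun q ↦ Real.log (b i (p, q))) (x.2 i) v) x.1 u := by
  rw [mvfderiv_mvfderiv_snd (contMDiff_log (hb i) (hpos i)), ricciOf_twisted_eq_trace hb hpos hP]
  exact ((isTwistedMetricOn_inChart (gB := gB) (gF := gF) hb hpos x).isTwistedCoeff
    (mem_extChartAt_target x) (fun _ hy ↦
      contDiffAt_fieldInChart hP (fst_mem_extChartAt_target hy)))
    |>.trace_curvatureMap_baseVec_fiberVec i u v

theorem ricciOf_ofFiber_ofBase (hb : ∀ i, ContMDiff (IB.prod (IF i)) 𝓘(ℝ) ∞ (b i))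
    (hpos : ∀ i p, 0 < b i p)
    (hP : ContMDiff IB IB.tangent ∞ (fun p ↦ (⟨p, P p⟩ : TangentBundle IB B)))
    (x : B × ∀ i, F i) (u : TangentSpace IB x.1) (i : ι) (v : TangentSpace (IF i) (x.2 i)) :
    ricciOf ((multiplyTwistedMetric gB gF b hb hpos).semiSymmetricConnection (liftBase P)) x
      (ofFiber i x v) (ofBase x u) = (Module.finrank ℝ (EF i) - 1) *
        mvfderiv IB (fun p ↦ mvfderiv (IF i) (fun q ↦ Real.log (b i (p, q))) (x.2 i) v) x.1 u := by
  rw [mvfderiv_mvfderiv_snd (contMDiff_log (hb i) (hpos i)), ricciOf_twisted_eq_trace hb hpos hP]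
  exact ((isTwistedMetricOn_inChart (gB := gB) (gF := gF) hb hpos x).isTwistedCoeff
    (mem_extChartAt_target x) (fun _ hy ↦
      contDiffAt_fieldInChart hP (fst_mem_extChartAt_target hy)))
    |>.trace_curvatureMap_fiberVec_baseVec i u v

end TwistedProduct

section Conformal

variable {E : Type*} [NormedAddCommGroup E] [NormedSpace ℝ E] [FiniteDimensional ℝ E]
  {H : Type*} [TopologicalSpace H] {I : ModelWithCorners ℝ E H} [I.Boundaryless]
  {M : Type*} [TopologicalSpace M] [ChartedSpace H M] [IsManifold I ∞ M]

namespace PseudoRiemannianMetric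

lemma ext_val {g g' : PseudoRiemannianMetric I M}
    (h : ∀ x (u v : TangentSpace I x), g.val x u v = g'.val x u v) : g = g' := by
  have e : g.val = g'.val := funext fun x ↦
    ContinuousLinearMap.ext fun u ↦ ContinuousLinearMap.ext fun v ↦ h x u v
  cases g
  cases g'
  cases e
  rfl

/-- The conformal change `f g` of a pseudo-Riemannian metric `g`. -/
def conformal (g : PseudoRiemannianMetric I M) (f : M → ℝ) (hf : ContMDiff I 𝓘(ℝ) ∞ f)
    (hf' : ∀ x, f x ≠ 0) : PseudoRiemannianMetric I M where
  val x := f x • g.val x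
  symm x u v := congrArg (f x * ·) (g.symm x u v)
  nondegenerate x u h := g.nondegenerate x u fun v ↦
    (mul_eq_zero.1 (h v)).resolve_left (hf' x)
  contMDiff := contMDiff_bilin _ fun x₀ _ _ hX hY ↦ (hf x₀).mul (g.contMDiffAt_val hX hY)

lemma exists_val_ne_zero (g : PseudoRiemannianMetric I M) (h : 0 < Module.finrank ℝ E) (x : M) :
    ∃ u v : TangentSpace I x, g.val x u v ≠ 0 := by
  have : Nontrivial E := Module.nontrivial_of_finrank_pos h
  obtain ⟨u, hu⟩ := exists_ne (0 : E)
  by_contra! hc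
  exact hu (g.nondegenerate x u fun v ↦ hc u v)

end PseudoRiemannianMetric

end Conformal

section Warped

variable {EB : Type*} [NormedAddCommGroup EB] [NormedSpace ℝ EB] [FiniteDimensional ℝ EB]
  {HB : Type*} [TopologicalSpace HB] {IB : ModelWithCorners ℝ EB HB} [IB.Boundaryless]
  {B : Type*} [TopologicalSpace B] [ChartedSpace HB B] [IsManifold IB ∞ B]
  {ι : Type*} [Fintype ι]
  {EF : ι → Type*} [∀ i, NormedAddCommGroup (EF i)] [∀ i, NormedSpace ℝ (EF i)]
  [∀ i, FiniteDimensional ℝ (EF i)]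
  {HF : ι → Type*} [∀ i, TopologicalSpace (HF i)] {IF : ∀ i, ModelWithCorners ℝ (EF i) (HF i)}
  [∀ i, (IF i).Boundaryless]
  {F : ι → Type*} [∀ i, TopologicalSpace (F i)] [∀ i, ChartedSpace (HF i) (F i)]
  [∀ i, IsManifold (IF i) ∞ (F i)]
  {gB : PseudoRiemannianMetric IB B} {gF : ∀ i, PseudoRiemannianMetric (IF i) (F i)}
  {b : ∀ i, B × F i → ℝ} {hb : ∀ i, ContMDiff (IB.prod (IF i)) 𝓘(ℝ) ∞ (b i)}
  {hpos : ∀ i p, 0 < b i p}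

lemma multiplyTwistedMetric_ofFiber [DecidableEq ι] (x : B × ∀ i, F i) (i : ι)
    (v w : TangentSpace (IF i) (x.2 i)) :
    (multiplyTwistedMetric gB gF b hb hpos).val x (ofFiber i x v) (ofFiber i x w) =
      b i (x.1, x.2 i) ^ 2 * (gF i).val (x.2 i) v w := by
  rw [multiplyTwistedMetric_val, Finset.sum_eq_single i (fun j _ hj ↦ by
    simp [fiberPart_ofFiber_ne hj]) (by simp), basePart_ofFiber, fiberPart_ofFiber_same,
    fiberPart_ofFiber_same]
  simp

lemma multiplyTwistedMetric_ofBase_ofFiber [DecidableEq ι] (x : B × ∀ i, F i)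
    (u : TangentSpace IB x.1) (i : ι) (v : TangentSpace (IF i) (x.2 i)) :
    (multiplyTwistedMetric gB gF b hb hpos).val x (ofBase x u) (ofFiber i x v) = 0 := by
  rw [multiplyTwistedMetric_val, basePart_ofFiber]
  simp [fiberPart_ofBase]

/-- A multiply twisted product is a multiply warped product if and only if the logarithms of the
twisting functions are sums of a function on the base and a function on the fibre. -/
lemma isMultiplyWarped_iff_log [Nonempty B] [∀ i, Nonempty (F i)]
    (hdim : ∀ i, 0 < Module.finrank ℝ (EF i)) :
    IsMultiplyWarped (multiplyTwistedMetric gB gF b hb hpos) ↔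
      ∀ i p p' q q', Real.log (b i (p, q)) - Real.log (b i (p', q)) =
        Real.log (b i (p, q')) - Real.log (b i (p', q')) := by
  classical
  constructor
  · rintro ⟨gB', gF', φ, hφ, hφpos, h⟩ i
    have key (p : B) (q : F i) (v w : TangentSpace (IF i) q) :
        b i (p, q) ^ 2 * (gF i).val q v w = φ i p ^ 2 * (gF' i).val q v w := by
      obtain ⟨y, rfl⟩ : ∃ y : ∀ j, F j, y i = q :=
        ⟨Function.update (fun _ ↦ Classical.arbitrary _) i q, Function.update_self ..⟩
      have h1 := congrArg (fun g ↦ g.val (p, y) (ofFiber i (p, y) v) (ofFiber i (p, y) w)) h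
      exact (multiplyTwistedMetric_ofFiber (p, y) i v w).symm.trans
        (h1.trans (multiplyTwistedMetric_ofFiber (p, y) i v w))
    have ratio (p p' : B) (q : F i) : Real.log (b i (p, q)) - Real.log (b i (p', q)) =
        Real.log (φ i p) - Real.log (φ i p') := by
      obtain ⟨v, w, hvw⟩ := (gF i).exists_val_ne_zero (hdim i) q
      have h1 := key p q v w
      have h2 := key p' q v w
      have h3 : (b i (p, q) * φ i p') ^ 2 = (b i (p', q) * φ i p) ^ 2 := by
        refine mul_right_cancel₀ hvw ?_
        linear_combination φ i p' ^ 2 * h1 - φ i p ^ 2 * h2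
      have h4 : b i (p, q) * φ i p' = b i (p', q) * φ i p :=
        (sq_eq_sq₀ (mul_pos (hpos i _) (hφpos i _)).le (mul_pos (hpos i _) (hφpos i _)).le).1 h3
      have h5 := congrArg Real.log h4
      rw [Real.log_mul (hpos i _).ne' (hφpos i _).ne',
        Real.log_mul (hpos i _).ne' (hφpos i _).ne'] at h5
      linarith
    intro p p' q q'
    rw [ratio, ratio]
  · intro h
    obtain ⟨p₀⟩ := ‹Nonempty B›
    let q₀ (i : ι) : F i := Classical.arbitrary _
    have hψ (i : ι) : ContMDiff (IF i) 𝓘(ℝ) ∞ fun q ↦ (b i (p₀, q) / b i (p₀, q₀ i)) ^ 2 := by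
      have h1 : ContMDiff (IF i) 𝓘(ℝ) ∞ fun q ↦ b i (p₀, q) :=
        (hb i).comp (contMDiff_const.prodMk contMDiff_id)
      exact (h1.div_const _).pow 2
    refine ⟨gB, fun i ↦ (gF i).conformal _ (hψ i)
        (fun q ↦ pow_ne_zero 2 (div_pos (hpos i _) (hpos i _)).ne'),
      fun i p ↦ b i (p, q₀ i), fun i ↦ (hb i).comp (contMDiff_id.prodMk contMDiff_const),
      fun i p ↦ hpos i _, PseudoRiemannianMetric.ext_val fun x u v ↦ ?_⟩
    rw [multiplyWarpedMetric, multiplyTwistedMetric_val, multiplyTwistedMetric_val]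
    refine congrArg _ (Finset.sum_congr rfl fun i _ ↦ ?_)
    have h1 : b i (x.1, x.2 i) = b i (x.1, q₀ i) * (b i (p₀, x.2 i) / b i (p₀, q₀ i)) := by
      refine Real.log_injOn_pos (hpos i _) (mul_pos (hpos i _) (div_pos (hpos i _) (hpos i _))) ?_
      rw [Real.log_mul (hpos i _).ne' (div_pos (hpos i _) (hpos i _)).ne',
        Real.log_div (hpos i _).ne' (hpos i _).ne']
      linarith [h i x.1 p₀ (x.2 i) (q₀ i)]
    rw [h1, mul_pow, mul_assoc]
    rfl

theorem isMixedRicciFlat_iff_isMultiplyWarped [DecidableEq ι] [ConnectedSpace B]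
    [∀ i, ConnectedSpace (F i)] (hdim : ∀ i, 1 < Module.finrank ℝ (EF i))
    {P : Π p : B, TangentSpace IB p}
    (hP : ContMDiff IB IB.tangent ∞ (fun p ↦ (⟨p, P p⟩ : TangentBundle IB B))) :
    IsMixedRicciFlat ((multiplyTwistedMetric gB gF b hb hpos).semiSymmetricConnection
        (liftBase P)) ↔
      IsMultiplyWarped (multiplyTwistedMetric gB gF b hb hpos) := by
  have hn (i : ι) : (Module.finrank ℝ (EF i) : ℝ) - 1 ≠ 0 :=
    (sub_pos.2 (Nat.one_lt_cast.2 (hdim i))).ne'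
  rw [isMultiplyWarped_iff_log fun i ↦ zero_lt_one.trans (hdim i)]
  simp only [← fun i ↦ mvfderiv_mvfderiv_snd_eq_zero_iff (contMDiff_log (hb i) (hpos i))]
  constructor
  · intro h i p q u v
    obtain ⟨y, rfl⟩ : ∃ y : ∀ j, F j, y i = q :=
      ⟨Function.update (fun _ ↦ Classical.arbitrary _) i q, Function.update_self ..⟩
    have h1 := (h (p, y) u i v).1
    rw [ricciOf_ofBase_ofFiber hb hpos hP] at h1
    exact (mul_eq_zero.1 h1).resolve_left (hn i)
  · intro h x u i v
    rw [ricciOf_ofBase_ofFiber hb hpos hP, ricciOf_ofFiber_ofBase hb hpos hP, h, mul_zero]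
    exact ⟨rfl, rfl⟩

lemma IsEinstein.isMixedRicciFlat [DecidableEq ι]
    {D : (Π x : B × ∀ i, F i, TangentSpace (productModel IB IF) x) →
      (Π x : B × ∀ i, F i, TangentSpace (productModel IB IF) x) →
      Π x : B × ∀ i, F i, TangentSpace (productModel IB IF) x}
    (h : IsEinstein (multiplyTwistedMetric gB gF b hb hpos) D) : IsMixedRicciFlat D := by
  obtain ⟨c, hc⟩ := h
  intro x u i v
  rw [hc, hc, (multiplyTwistedMetric gB gF b hb hpos).symm x (ofFiber i x v) (ofBase x u),
    multiplyTwistedMetric_ofBase_ofFiber, mul_zero]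
  exact ⟨rfl, rfl⟩

end Warped

end

theorem corollary4p6
    {EB : Type*} [NormedAddCommGroup EB] [NormedSpace ℝ EB] [FiniteDimensional ℝ EB]
    {B : Type*} [TopologicalSpace B] [ChartedSpace EB B] [IsManifold 𝓘(ℝ, EB) ∞ B]
    [ConnectedSpace B]
    {m : ℕ} {EF : Fin m → Type*} [∀ i, NormedAddCommGroup (EF i)] [∀ i, NormedSpace ℝ (EF i)]
    [∀ i, FiniteDimensional ℝ (EF i)]
    {F : Fin m → Type*} [∀ i, TopologicalSpace (F i)] [∀ i, ChartedSpace (EF i) (F i)]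
    [∀ i, IsManifold 𝓘(ℝ, EF i) ∞ (F i)] [∀ i, ConnectedSpace (F i)]
    (hdim : ∀ i, 1 < Module.finrank ℝ (EF i))
    (gB : PseudoRiemannianMetric 𝓘(ℝ, EB) B)
    (gF : ∀ i, PseudoRiemannianMetric 𝓘(ℝ, EF i) (F i))
    (b : ∀ i, B × F i → ℝ)
    (hb : ∀ i, ContMDiff (𝓘(ℝ, EB).prod 𝓘(ℝ, EF i)) 𝓘(ℝ) ∞ (b i))
    (hpos : ∀ i p, 0 < b i p)
    (P : Π p : B, TangentSpace 𝓘(ℝ, EB) p)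
    (hP : ContMDiff 𝓘(ℝ, EB) 𝓘(ℝ, EB).tangent ∞ (fun p ↦ (⟨p, P p⟩ : TangentBundle 𝓘(ℝ, EB) B))) :
    (IsMixedRicciFlat ((multiplyTwistedMetric gB gF b hb hpos).semiSymmetricConnection
        (liftBase P)) ↔
      IsMultiplyWarped (multiplyTwistedMetric gB gF b hb hpos)) ∧
    (IsEinstein (multiplyTwistedMetric gB gF b hb hpos)
        ((multiplyTwistedMetric gB gF b hb hpos).semiSymmetricConnection (liftBase P)) →
      IsMultiplyWarped (multiplyTwistedMetric gB gF b hb hpos)) := by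
  exact ⟨isMixedRicciFlat_iff_isMultiplyWarped hdim hP, fun h ↦
    (isMixedRicciFlat_iff_isMultiplyWarped hdim hP).1 h.isMixedRicciFlat⟩
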